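/- For $0<q<1$ write $A_q=\{z\in\mathbb C: q<|z|<1\}$, $q=e^{a}$ with $a<0$, and $\mathbb U=\{|z|<1\}$. Let $L=L(q)\in[0,1)$ be such that $A_q$ and $\mathbb U\setminus[-L,L]$ are conformally equivalent, and let $f=f_q:A_q\to\mathbb U\setminus[-L,L]$ be the conformal equivalence normalized by $f(1)=1$, meaning $f(z)\to1$ as $z\to1$ in $A_q$. For positive functions write $h(a)\asymp g(a)$ as $a\nearrow0$ if $\lim_{a\nearrow0}\log h(a)/\log g(a)=1$. Then $$1-L\asymp e^{\pi^2/(4a)}\qquad\text{as } a\nearrow0 .$$ Moreover $f$ extends to the outer circle $|z|=1$ by its boundary values, and the extended map, still denoted $f$, has at each point of this circle a complex derivative relative to $\{q<|z|\le1\}$, denoted $f'$. For every $x\in(0,\pi)$, with $z_1=e^{ix/2}$, $$|f'(z_1)|\asymp|1-f(z_1)|\asymp e^{\frac{\pi}{4a}(\pi-x)}\qquad\text{as } a\nearrow0 ,$$ and also $|f'(z_1)|\asymp e^{\frac{\pi}{4a}(\pi-x)}$. For $x=\pi$, i.e. $z_1=i$, where this exponential is identically $1$, one has $$\lim_{a\nearrow0}a\log|f'(i)|=0\quad\text{and}\quad\lim_{a\nearrow0}a\log|1-f(i)|=0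 .$$ -/

import Mathlib

open Set Filter Topology

/-- The annulus `A_q = {q < |z| < 1}`. -/
def annulus (q : ℝ) : Set ℂ := {z : ℂ | q < ‖z‖ ∧ ‖z‖ < 1}

/-- The annulus together with its outer boundary circle, `{q < |z| ≤ 1}`. -/
def annulusOuter (q : ℝ) : Set ℂ := {z : ℂ | q < ‖z‖ ∧ ‖z‖ ≤ 1}

/-- The slit disk: the open unit disk minus the real interval `[-L, L]`. -/
def slitDisk (L : ℝ) : Set ℂ := Metric.ball (0 : ℂ) 1 \ ((fun t : ℝ => (t : ℂ)) '' Icc (-L) L)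

/-- `f` is a conformal equivalence of `U` onto `V`: a holomorphic bijection
(for open `U` its inverse is then automatically holomorphic). -/
def IsConformalEquiv (f : ℂ → ℂ) (U V : Set ℂ) : Prop :=
  DifferentiableOn ℂ f U ∧ BijOn f U V

/-- `U` and `V` are conformally equivalent. -/
def ConformallyEquivalent (U V : Set ℂ) : Prop := ∃ f : ℂ → ℂ, IsConformalEquiv f U V

/-- `f` is a conformal equivalence of `A_q` onto the slit disk, normalized by `f(1) = 1`. Only the
values of `f` on the open annulus matter, so `f(1)` is the boundary value of `f` at `1`. -/
def IsNormalizedSlitMap (q L : ℝ) (f : ℂ → ℂ) : Prop :=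
  IsConformalEquiv f (annulus q) (slitDisk L) ∧ Tendsto f (𝓝[annulus q] 1) (𝓝 1)

/-- The extension of `f` from the annulus by its boundary values. -/
noncomputable def boundaryExtension (q : ℝ) (f : ℂ → ℂ) : ℂ → ℂ := extendFrom (annulus q) f

/-- The derivative `f'(z)` of the extended map, also at points `z` of the outer circle, where the
difference quotient is taken within `{q < |z| ≤ 1}`. -/
noncomputable def boundaryDeriv (q : ℝ) (f : ℂ → ℂ) (z : ℂ) : ℂ :=
  derivWithin (boundaryExtension q f) (annulusOuter q) z

/-- `h(a) ≍ g(a)` as `a ↗ 0`: the quotient of the logarithms tends to `1`. -/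
def LogAsymp (h g : ℝ → ℝ) : Prop :=
  Tendsto (fun a : ℝ => Real.log (h a) / Real.log (g a)) (𝓝[<] 0) (𝓝 1)

/-- The boundary point `z₁ = e^{ix/2}`. -/
noncomputable def bdryPoint (x : ℝ) : ℂ := Complex.exp (Complex.I * (x : ℂ) / 2)

/-! The slit disk has an explicit uniformizer. With `p = L²`, let `s` solve `L cosh s = w` and let
`Λ` be the primitive of `(1 - p² cosh² s)^{-1/2}` with `Λ(0) = 0`. The slit corresponds to `Re s =
0`, where `Re Λ = 0`. On `|w| = 1` the derivative of `Λ` with respect to `log w` is `1 / |1 - L²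
w²|`, which is real, so `Re Λ` is constant there, say `M`. Dividing by the mean `κ` of this density
over the circle gives `Λ` the period `2πi`, so `G = exp(Λ / κ)` is single valued, with modulus `1`
at the slit and `ρ = exp(M / κ)` on the unit circle (`exists_isSlitUniformizer`).

For a conformal map `f` of the annulus onto the slit disk, `|G ∘ f|` is asymptotically constant at
both ends, so `G ∘ f` is a monomial (`exists_eq_const_mul_zpow`). Its exponent is `±1` by winding,
and `ρ q = 1` follows (`IsSlitUniformizer.rigidity`), that is `M = -a κ`. The normalization gives
`G(f(z)) = G(1) z`. With `J(θ)` the integral of the density over `[0, θ]`, this says `f(e^{iτ}) =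
e^{iθ}` with `J(θ) = κ τ`, and `|f'(e^{iτ})| = κ |1 - L² e^{2iθ}|` (`IsNormalizedSlitMap.boundary`).

The rest is real analysis. `M` lies between two multiples of an arcsine, both tending to `π/4` as `L
→ 1`, so `a κ → -π/4`. Also `2L J(θ)` equals `arsinh(2L sin θ / (1 - L²))` up to a bounded error
(`angularInt_bounds`). Taking `θ = π/2` gives `log(1 - L) = -L κ π + O(1)`, hence `a log(1 - L) →
π²/4`. Taking `J(θ) = κ x / 2` gives `a log sin θ → π(π - x)/4`, and both `|1 - f|` and `|f'| / κ`
are comparable to `sin θ`, while `a log κ → 0`. -/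

/-! ### Ends of an annulus, maximum principle and monomials. -/

/-- The filter of points of the plane whose norm tends to `1` from below. -/
noncomputable def outerEnd : Filter ℂ := comap norm (𝓝[<] (1 : ℝ))

/-- The filter of points of the plane whose norm tends to `q` from above. -/
noncomputable def innerEnd (q : ℝ) : Filter ℂ := comap norm (𝓝[>] q)

lemma annulus_mem_outerEnd {q : ℝ} (hq : q < 1) : annulus q ∈ outerEnd :=
  ⟨Ioo q 1, Ioo_mem_nhdsLT hq, fun _ h => h⟩

lemma annulus_mem_innerEnd {q : ℝ} (hq : q < 1) : annulus q ∈ innerEnd q :=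
  ⟨Ioo q 1, Ioo_mem_nhdsGT hq, fun _ h => h⟩

lemma eventually_outerEnd {P : ℂ → Prop} :
    (∀ᶠ z in outerEnd, P z) ↔ ∃ s < 1, ∀ z : ℂ, s < ‖z‖ → ‖z‖ < 1 → P z := by
  rw [outerEnd, eventually_comap, eventually_iff, mem_nhdsLT_iff_exists_Ioo_subset]
  constructor
  · rintro ⟨s, hs, h⟩
    exact ⟨s, hs, fun z h1 h2 => h ⟨h1, h2⟩ z rfl⟩
  · rintro ⟨s, hs, h⟩
    exact ⟨s, hs, fun r hr z hz => h z (hz ▸ hr.1) (hz ▸ hr.2)⟩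

lemma eventually_innerEnd {q : ℝ} {P : ℂ → Prop} :
    (∀ᶠ z in innerEnd q, P z) ↔ ∃ s > q, ∀ z : ℂ, q < ‖z‖ → ‖z‖ < s → P z := by
  rw [innerEnd, eventually_comap, eventually_iff, mem_nhdsGT_iff_exists_Ioo_subset]
  constructor
  · rintro ⟨s, hs, h⟩
    exact ⟨s, hs, fun z h1 h2 => h ⟨h1, h2⟩ z rfl⟩
  · rintro ⟨s, hs, h⟩
    exact ⟨s, hs, fun r hr z hz => h z (hz ▸ hr.1) (hz ▸ hr.2)⟩

lemma isOpen_annulus (q : ℝ) : IsOpen (annulus q) :=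
  (isOpen_lt continuous_const continuous_norm).inter (isOpen_lt continuous_norm continuous_const)

lemma exp_mem_annulus {q : ℝ} (hq : 0 < q) {t : ℂ} (ht : t.re ∈ Ioo (Real.log q) 0) :
    Complex.exp t ∈ annulus q := by
  simp only [annulus, mem_ofPred_eq, Complex.norm_exp, Real.exp_lt_one_iff]
  exact ⟨(Real.log_lt_iff_lt_exp hq).1 ht.1, ht.2⟩

lemma norm_exp_ofReal_mul (α : ℝ) (t : ℂ) :
    ‖Complex.exp ((α : ℂ) * t)‖ = ‖Complex.exp t‖ ^ α := by
  rw [Complex.norm_exp, Complex.norm_exp, ← Real.exp_mul]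
  simp [mul_comm]

/-- A maximum principle on an annulus for `|g(z)| |z|^α`. -/
lemma norm_mul_rpow_le_of_ends {q : ℝ} (hq : q ∈ Ioo (0 : ℝ) 1) {g : ℂ → ℂ}
    (hg : DifferentiableOn ℂ g (annulus q)) {α C : ℝ}
    (hout : ∀ ε > 0, ∀ᶠ z in outerEnd, ‖g z‖ * ‖z‖ ^ α ≤ C + ε)
    (hinn : ∀ ε > 0, ∀ᶠ z in innerEnd q, ‖g z‖ * ‖z‖ ^ α ≤ C + ε) :
    ∀ z ∈ annulus q, ‖g z‖ * ‖z‖ ^ α ≤ C := by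
  intro z hz
  refine le_of_forall_pos_le_add fun ε hε => ?_
  obtain ⟨s, hs, h1⟩ := eventually_outerEnd.1 (hout ε hε)
  obtain ⟨s', hs', h2⟩ := eventually_innerEnd.1 (hinn ε hε)
  obtain ⟨b, hb1, hb2⟩ := exists_between (max_lt hs hz.2)
  obtain ⟨a, ha1, ha2⟩ := exists_between (lt_min hs' hz.1)
  rw [max_lt_iff] at hb1
  rw [lt_min_iff] at ha2
  have ha0 : 0 < a := hq.1.trans ha1
  have hz0 : 0 < ‖z‖ := hq.1.trans hz.1
  have hb0 : 0 < b := hz0.trans hb1.2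
  have hab : a < b := ha2.2.trans hb1.2
  -- In the logarithmic coordinate `|z|^α` is the modulus of the holomorphic function `exp(α t)`
  -- even when `α` is not an integer, so Phragmén–Lindelöf on a strip applies.
  set F : ℂ → ℂ := fun t => g (Complex.exp t) * Complex.exp ((α : ℂ) * t) with hF
  have hFn : ∀ t, ‖F t‖ = ‖g (Complex.exp t)‖ * ‖Complex.exp t‖ ^ α := fun t => by
    rw [hF, norm_mul, norm_exp_ofReal_mul]
  have hmem : ∀ t : ℂ, t.re ∈ Icc (Real.log a) (Real.log b) →
      Complex.exp t ∈ {z : ℂ | a ≤ ‖z‖ ∧ ‖z‖ ≤ b} := fun t ht => by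
    simp only [mem_ofPred_eq, Complex.norm_exp]
    exact ⟨(Real.log_le_iff_le_exp ha0).1 ht.1, (Real.le_log_iff_exp_le hb0).1 ht.2⟩
  have hsub : {z : ℂ | a ≤ ‖z‖ ∧ ‖z‖ ≤ b} ⊆ annulus q := fun z hz =>
    ⟨ha1.trans_le hz.1, hz.2.trans_lt hb2⟩
  have hcpt : IsCompact {z : ℂ | a ≤ ‖z‖ ∧ ‖z‖ ≤ b} := by
    refine (isCompact_closedBall (0 : ℂ) b).of_isClosed_subset ?_ fun z hz => by simpa using hz.2
    exact (isClosed_le continuous_const continuous_norm).inter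
      (isClosed_le continuous_norm continuous_const)
  have hdiff : DifferentiableOn ℂ F (Complex.re ⁻¹' Icc (Real.log a) (Real.log b)) := by
    refine DifferentiableOn.mul ?_ (by fun_prop)
    exact (hg.mono hsub).comp Complex.differentiable_exp.differentiableOn fun t ht => hmem t ht
  -- The strip covers a compact ring, so `F` is bounded and the growth condition below holds with
  -- both constants `0`.
  obtain ⟨B, hB⟩ := hcpt.exists_bound_of_continuousOn
    (f := fun z => ‖g z‖ * ‖z‖ ^ α) (by
      refine ContinuousOn.mul (hg.mono hsub).continuousOn.norm ?_
      refine ContinuousOn.rpow_const continuous_norm.continuousOn fun z hz => Or.inl ?_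
      exact (ha0.trans_le hz.1).ne')
  have hlog : Real.log a < Real.log b := Real.log_lt_log ha0 hab
  have key : ∀ t : ℂ, t.re ∈ Icc (Real.log a) (Real.log b) → ‖F t‖ ≤ C + ε := by
    intro t ht
    refine PhragmenLindelof.vertical_strip (a := Real.log a) (b := Real.log b) ?_ ?_ ?_ ?_ ht.1 ht.2
    · apply DifferentiableOn.diffContOnCl
      refine hdiff.mono ?_
      rw [Complex.closure_preimage_re, closure_Ioo hlog.ne]
    · refine ⟨0, div_pos Real.pi_pos (sub_pos.2 hlog), 0, ?_⟩
      refine Asymptotics.IsBigO.of_bound B ?_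
      refine Filter.Eventually.filter_mono inf_le_right ?_
      rw [eventually_principal]
      intro t ht
      have := hB _ (hmem t (Ioo_subset_Icc_self ht))
      rw [hFn]
      simpa using (le_abs_self _).trans this
    · intro t ht
      have : ‖Complex.exp t‖ = a := by rw [Complex.norm_exp, ht, Real.exp_log ha0]
      rw [hFn]
      exact h2 _ (this ▸ ha1) (this ▸ ha2.1)
    · intro t ht
      have : ‖Complex.exp t‖ = b := by rw [Complex.norm_exp, ht, Real.exp_log hb0]
      rw [hFn]
      exact h1 _ (this ▸ hb1.1) (this ▸ hb2)
  have := key (Complex.log z) ⟨by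
    rw [Complex.log_re]; exact Real.log_le_log ha0 ha2.2.le, by
    rw [Complex.log_re]; exact Real.log_le_log hz0 hb1.2.le⟩
  rwa [hFn, Complex.exp_log (norm_pos_iff.1 hz0)] at this

/-- A nowhere vanishing holomorphic function on an annulus whose norm is asymptotically constant at
each of the two ends is a monomial. -/
lemma exists_eq_const_mul_zpow {q : ℝ} (hq : q ∈ Ioo (0 : ℝ) 1) {g : ℂ → ℂ}
    (hg : DifferentiableOn ℂ g (annulus q)) (hg0 : ∀ z ∈ annulus q, g z ≠ 0) {A B : ℝ}
    (hA : 0 < A) (hB : 0 < B) (hout : Tendsto (fun z => ‖g z‖) outerEnd (𝓝 A))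
    (hinn : Tendsto (fun z => ‖g z‖) (innerEnd q) (𝓝 B)) :
    ∃ (c : ℂ) (n : ℤ), c ≠ 0 ∧ ‖c‖ = A ∧ A * q ^ n = B ∧ ∀ z ∈ annulus q, g z = c * z ^ n := by
  have hlq : Real.log q < 0 := Real.log_neg hq.1 hq.2
  -- The exponent for which `A r^α` is `A` at `r = 1` and `B` at `r = q`. The maximum principle for
  -- `g` and for `1/g` then forces `|g(z)| = A |z|^α`.
  set α : ℝ := Real.log (B / A) / Real.log q with hα
  have hqα : A * q ^ α = B := by
    rw [Real.rpow_def_of_pos hq.1, hα, mul_div_cancel₀ _ hlq.ne, Real.exp_log (div_pos hB hA)]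
    field_simp
  have hn1 : Tendsto (fun z : ℂ => ‖z‖) outerEnd (𝓝 1) :=
    tendsto_comap.mono_right nhdsWithin_le_nhds
  have hnq : Tendsto (fun z : ℂ => ‖z‖) (innerEnd q) (𝓝 q) :=
    tendsto_comap.mono_right nhdsWithin_le_nhds
  have hr1 : ∀ β : ℝ, Tendsto (fun z : ℂ => ‖z‖ ^ β) outerEnd (𝓝 1) := fun β => by
    simpa using hn1.rpow_const (p := β) (Or.inl one_ne_zero)
  have hrq : ∀ β : ℝ, Tendsto (fun z : ℂ => ‖z‖ ^ β) (innerEnd q) (𝓝 (q ^ β)) := fun β =>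
    hnq.rpow_const (p := β) (Or.inl hq.1.ne')
  have ev : ∀ {l : Filter ℂ} {u : ℂ → ℝ} {C : ℝ}, Tendsto u l (𝓝 C) →
      ∀ ε > 0, ∀ᶠ z in l, u z ≤ C + ε := fun h ε hε =>
    (h.eventually (gt_mem_nhds (lt_add_of_pos_right _ hε))).mono fun _ h => h.le
  have hle := norm_mul_rpow_le_of_ends hq hg (α := -α) (C := A)
    (ev (by simpa using hout.mul (hr1 (-α))))
    (ev (by
      have := hinn.mul (hrq (-α))
      rwa [← hqα, Real.rpow_neg hq.1.le, mul_inv_cancel_right₀ (Real.rpow_pos_of_pos hq.1 _).ne']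
        at this))
  have hge := norm_mul_rpow_le_of_ends hq (g := fun z => (g z)⁻¹) (hg.inv hg0) (α := α) (C := A⁻¹)
    (ev (by simpa using (hout.inv₀ hA.ne').mul (hr1 α)))
    (ev (by
      have := (hinn.inv₀ hB.ne').mul (hrq α)
      simp only [norm_inv]
      rwa [← hqα, mul_inv, inv_mul_cancel_right₀ (Real.rpow_pos_of_pos hq.1 _).ne'] at this))
  set T : Set ℂ := Complex.re ⁻¹' Ioo (Real.log q) 0 with hT
  set F : ℂ → ℂ := fun t => g (Complex.exp t) * Complex.exp (((-α : ℝ) : ℂ) * t) with hF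
  have hFn : ∀ t ∈ T, ‖F t‖ = A := by
    intro t ht
    have hm := exp_mem_annulus hq.1 ht
    have hp : 0 < ‖Complex.exp t‖ := hq.1.trans hm.1
    have h1 := hle _ hm
    have h2 := hge _ hm
    rw [hF, norm_mul, norm_exp_ofReal_mul]
    refine le_antisymm h1 ?_
    have hgp : 0 < ‖g (Complex.exp t)‖ := norm_pos_iff.2 (hg0 _ hm)
    rw [Real.rpow_neg hp.le]
    rw [norm_inv, ← inv_inv (‖Complex.exp t‖ ^ α), ← mul_inv,
      inv_le_inv₀ (by positivity) hA] at h2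
    exact h2
  have hTc : Convex ℝ T := (convex_Ioo _ _).linear_preimage Complex.reLm
  have hTo : IsOpen T := isOpen_Ioo.preimage Complex.continuous_re
  set t₀ : ℂ := ((Real.log q / 2 : ℝ) : ℂ) with ht₀
  have ht₀T : t₀ ∈ T := by
    simp only [hT, ht₀, mem_preimage, Complex.ofReal_re, mem_Ioo]
    constructor <;> linarith
  have hconst := Complex.eqOn_of_isPreconnected_of_isMaxOn_norm (f := F) hTc.isPreconnected hTo
    (DifferentiableOn.mul (hg.comp Complex.differentiable_exp.differentiableOn
      fun t ht => exp_mem_annulus hq.1 ht) (by fun_prop)) ht₀T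
    (fun t ht => by simp only [mem_ofPred_eq, Function.comp_apply, hFn t ht, hFn t₀ ht₀T]; exact le_rfl)
  have hform : ∀ t ∈ T, g (Complex.exp t) = F t₀ * Complex.exp ((α : ℂ) * t) := by
    intro t ht
    have : F t = F t₀ := hconst ht
    rw [← this, hF]
    simp only
    rw [mul_assoc, ← Complex.exp_add]
    simp
  have hc0 : F t₀ ≠ 0 := norm_pos_iff.1 (by rw [hFn t₀ ht₀T]; exact hA)
  -- Points `2πi` apart have the same image under `exp`, so `exp(2πi α) = 1`.
  obtain ⟨n, hn⟩ : ∃ n : ℤ, (α : ℂ) = n := by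
    have h1 := hform t₀ ht₀T
    have h2 := hform (t₀ + 2 * Real.pi * Complex.I) (by simpa [hT] using ht₀T)
    rw [Complex.exp_periodic, h1] at h2
    have h3 := mul_left_cancel₀ hc0 h2
    rw [mul_add, Complex.exp_add, eq_comm, mul_eq_left₀ (Complex.exp_ne_zero _),
      Complex.exp_eq_one_iff] at h3
    obtain ⟨n, hn⟩ := h3
    exact ⟨n, mul_right_cancel₀ Complex.two_pi_I_ne_zero hn⟩
  have hn' : α = n := by exact_mod_cast hn
  refine ⟨F t₀, n, hc0, hFn t₀ ht₀T, ?_, fun z hz => ?_⟩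
  · rw [← hqα, hn', Real.rpow_intCast]
  · have hz0 : z ≠ 0 := norm_pos_iff.1 (hq.1.trans hz.1)
    have := hform (Complex.log z) (by
      simp only [hT, mem_preimage, Complex.log_re]
      exact ⟨Real.log_lt_log hq.1 hz.1, Real.log_neg (hq.1.trans hz.1) hz.2⟩)
    rwa [Complex.exp_log hz0, hn, Complex.exp_int_mul, Complex.exp_log hz0] at this

/-- If a loop `exp ∘ γ` of winding number one is a constant multiple of the `n`-th power of a loop,
then `n = ±1`. -/
lemma isUnit_of_exp_eq_const_mul_zpow {γ y : ℝ → ℂ} (hγ : Continuous γ) (hy : Continuous y)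
    (hy0 : ∀ t, y t ≠ 0) {a b : ℝ} (hyab : y a = y b)
    (hγab : γ b = γ a + 2 * Real.pi * Complex.I) {c : ℂ} {n : ℤ}
    (h : ∀ t, Complex.exp (γ t) = c * y t ^ n) : IsUnit n := by
  obtain ⟨l, hlc, hl⟩ := Complex.exists_continuousOn_eqOn_exp_comp (U := (univ : Set ℝ)) (g := y)
    (by
      have := (convex_univ (𝕜 := ℝ) (E := ℝ)).contractibleSpace univ_nonempty
      show SimplyConnectedSpace (univ : Set ℝ)
      infer_instance) isOpen_univ hy.continuousOn (by simpa using hy0)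
  rw [continuousOn_univ] at hlc
  have hl' : ∀ t, Complex.exp (l t) = y t := fun t => hl (mem_univ t)
  have hd : ∀ t, Complex.exp (γ t - n * l t) = c := fun t => by
    rw [Complex.exp_sub, h, Complex.exp_int_mul, hl',
      mul_div_cancel_right₀ _ (zpow_ne_zero _ (hy0 t))]
  -- Both sides lift the constant loop `c` through `exp`. Comparing the endpoints gives `n m = 1`,
  -- where `m` is the winding number of `y`.
  have hconst : (fun t => γ t - n * l t) = fun _ => γ a - n * l a :=
    Complex.isCoveringMap_exp.eq_of_comp_eq (by fun_prop) (by fun_prop)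
      (funext fun t => Subtype.ext ((hd t).trans (hd a).symm)) a rfl
  have hb := congrFun hconst b
  have he : Complex.exp (l b) = Complex.exp (l a) := by rw [hl', hl', hyab]
  obtain ⟨m, hm⟩ := Complex.exp_eq_exp_iff_exists_int.1 he
  refine IsUnit.of_mul_eq_one m ?_
  simp only [hγab, hm] at hb
  have : ((n * m : ℤ) : ℂ) * (2 * Real.pi * Complex.I) = 1 * (2 * Real.pi * Complex.I) := by
    push_cast
    linear_combination -hb
  exact_mod_cast mul_right_cancel₀ Complex.two_pi_I_ne_zero this

/-! ### The primitive of `(1 - p² cosh² s)^{-1/2}`. -/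

/-- If `k` is holomorphic on the unit disk, `φ` is entire and all sublevel sets of `|φ|` of levels in
`(R, 1)` are connected, then `k ∘ φ` has a primitive on `{|φ| < 1}`. -/
lemma exists_primitive_comp {k φ : ℂ → ℂ} (hk : DifferentiableOn ℂ k (Metric.ball 0 1))
    (hφ : Differentiable ℂ φ) {s₀ : ℂ} {R : ℝ} (hR : R < 1) (hR0 : ‖φ s₀‖ ≤ R)
    (hconn : ∀ ρ, R < ρ → IsPreconnected {s | ‖φ s‖ < ρ}) :
    ∃ Λ : ℂ → ℂ, Λ s₀ = 0 ∧ ∀ s, ‖φ s‖ < 1 → HasDerivAt Λ (k (φ s)) s := by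
  set a : ℕ → ℂ := fun n => (n.factorial : ℂ)⁻¹ * iteratedDeriv n k 0 with ha
  have hsum : ∀ v : ℂ, ‖v‖ < 1 → HasSum (fun n => a n * v ^ n) (k v) := fun v hv => by
    have := Complex.hasSum_taylorSeries_on_ball hk (z := v) (by simpa using hv)
    simp only [sub_zero, smul_eq_mul] at this
    refine this.congr_fun fun n => ?_
    simp only [ha]; ring
  -- Each term `φ^n` of the Taylor expansion is entire, so it has an entire primitive. Summing these
  -- needs only connected sublevel sets, not simple connectivity.
  have hP : ∀ n : ℕ, ∃ P : ℂ → ℂ, P s₀ = 0 ∧ ∀ s ∈ univ, HasDerivAt P (φ s ^ n) s := fun n =>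
    (hφ.pow n).isExactOn_univ.with_val_at s₀ 0
  choose P hP0 hP using hP
  refine ⟨fun s => ∑' n, a n * P n s, by simp [hP0], fun s hs => ?_⟩
  obtain ⟨ρ, hρ1, hρ2⟩ := exists_between (max_lt hs hR)
  rw [max_lt_iff] at hρ1
  have hρ0 : 0 ≤ ρ := (norm_nonneg _).trans hρ1.1.le
  have hu : Summable fun n => ‖a n‖ * ρ ^ n := by
    have := (hsum (ρ : ℂ) (by simpa [abs_of_nonneg hρ0] using hρ2)).summable.norm
    simpa [abs_of_nonneg hρ0] using this
  have key := hasDerivAt_tsum_of_isPreconnected (g := fun n s => a n * P n s)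
    (g' := fun n s => a n * φ s ^ n) (t := {s | ‖φ s‖ < ρ}) hu
    (isOpen_lt hφ.continuous.norm continuous_const) (hconn ρ hρ1.2)
    (fun n y _ => (hP n y (mem_univ _)).const_mul _)
    (fun n y hy => by
      rw [norm_mul, norm_pow]
      exact mul_le_mul_of_nonneg_left (pow_le_pow_left₀ (norm_nonneg _) (le_of_lt hy) _)
        (norm_nonneg _))
    (y₀ := s₀) (y := s) (hR0.trans_lt hρ1.2) (by simp [hP0, summable_zero]) hρ1.1
  rwa [(hsum _ hs).tsum_eq] at key

lemma Complex.sq_norm_cosh (s : ℂ) :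
    ‖Complex.cosh s‖ ^ 2 = Real.sinh s.re ^ 2 + Real.cos s.im ^ 2 := by
  have : Complex.cosh s = (Real.cosh s.re * Real.cos s.im : ℝ) +
      (Real.sinh s.re * Real.sin s.im : ℝ) * Complex.I := by
    conv_lhs => rw [← Complex.re_add_im s]
    rw [Complex.cosh_add, Complex.cosh_mul_I, Complex.sinh_mul_I]
    push_cast
    ring
  rw [this, Complex.sq_norm, Complex.normSq_add_mul_I]
  have h1 := Real.cosh_sq s.re
  have h2 := Real.sin_sq_add_cos_sq s.im
  linear_combination Real.cos s.im ^ 2 * h1 + Real.sinh s.re ^ 2 * h2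

lemma Complex.norm_cosh_le_of_abs_re_le {s t : ℂ} (hre : |s.re| ≤ |t.re|) (him : s.im = t.im) :
    ‖Complex.cosh s‖ ≤ ‖Complex.cosh t‖ := by
  refine le_of_sq_le_sq ?_ (norm_nonneg _)
  rw [Complex.sq_norm_cosh, Complex.sq_norm_cosh, him]
  have : Real.sinh s.re ^ 2 ≤ Real.sinh t.re ^ 2 := by
    rw [← sq_abs, ← sq_abs (Real.sinh t.re), Real.abs_sinh, Real.abs_sinh]
    exact pow_le_pow_left₀ (Real.sinh_nonneg_iff.2 (abs_nonneg _)) (Real.sinh_le_sinh.2 hre) 2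
  linarith

lemma Complex.norm_cosh_le_cosh_re (s : ℂ) : ‖Complex.cosh s‖ ≤ Real.cosh s.re := by
  refine le_of_sq_le_sq ?_ (Real.cosh_pos _).le
  rw [Complex.sq_norm_cosh, Real.cosh_sq]
  have := Real.cos_sq_le_one s.im
  linarith

lemma Complex.norm_cosh_of_re_eq_zero {s : ℂ} (hs : s.re = 0) : ‖Complex.cosh s‖ ≤ 1 := by
  simpa [hs] using Complex.norm_cosh_le_cosh_re s

/-- At fixed imaginary part `|cosh|` decreases as `|Re s|` does, so a horizontal segment inside the
set joins each point to the imaginary axis, which lies in the set because `p < R`. -/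
lemma isPreconnected_norm_cosh_lt {p R : ℝ} (hp : 0 < p) (hR : p < R) :
    IsPreconnected {s : ℂ | ‖(p : ℂ) * Complex.cosh s‖ < R} := by
  have haxis : ∀ s : ℂ, s.re = 0 → ‖(p : ℂ) * Complex.cosh s‖ < R := fun s hs => by
    rw [norm_mul, Complex.norm_real, Real.norm_of_nonneg hp.le]
    exact (mul_le_of_le_one_right hp.le (Complex.norm_cosh_of_re_eq_zero hs)).trans_lt hR
  have hIc : Convex ℝ {s : ℂ | s.re = 0} :=
    convex_hyperplane (f := Complex.re) Complex.reLm.isLinear 0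
  refine isPreconnected_of_forall (0 : ℂ) fun s hs => ⟨{t | t.re = 0} ∪
    segment ℝ (Complex.I * s.im) s, union_subset (fun t ht => haxis t ht) ?_,
    Or.inl (by simp), Or.inr (right_mem_segment ℝ _ _), ?_⟩
  · rintro t ⟨a, b, ha, hb, hab, rfl⟩
    have hs' : ‖(p : ℂ) * Complex.cosh s‖ < R := hs
    refine lt_of_le_of_lt (b := ‖(p : ℂ) * Complex.cosh s‖) ?_ hs'
    rw [norm_mul, norm_mul]
    refine mul_le_mul_of_nonneg_left (Complex.norm_cosh_le_of_abs_re_le ?_ ?_) (norm_nonneg _)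
    · simp only [Complex.add_re, Complex.real_smul, Complex.mul_re, Complex.ofReal_re,
        Complex.ofReal_im, Complex.I_re, Complex.I_im, Complex.mul_im]
      simp only [zero_mul, mul_zero, sub_self, sub_zero, zero_add]
      rw [abs_mul, abs_of_nonneg hb]
      exact mul_le_of_le_one_left (abs_nonneg _) (by linarith)
    · simp [← add_mul, hab]
  · refine IsPreconnected.union (Complex.I * s.im) (by simp) (left_mem_segment ℝ _ _)
      hIc.isPreconnected (convex_segment _ _).isPreconnected

/-- The branch of `(1 - v)^{-1/2}` on the unit disk. -/
noncomputable def invSqrtOneSub (v : ℂ) : ℂ := (1 - v) ^ (-(1 / 2) : ℂ)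

lemma one_sub_mem_slitPlane {v : ℂ} (hv : ‖v‖ < 1) : 1 - v ∈ Complex.slitPlane := by
  refine Or.inl ?_
  have := (abs_le.1 (Complex.abs_re_le_norm v)).2
  simp only [Complex.sub_re, Complex.one_re]
  linarith

lemma differentiableOn_invSqrtOneSub : DifferentiableOn ℂ invSqrtOneSub (Metric.ball 0 1) := by
  intro v hv
  have := one_sub_mem_slitPlane (v := v) (by simpa using hv)
  exact (DifferentiableAt.cpow_const (by fun_prop) this).differentiableWithinAt

lemma norm_invSqrtOneSub_le {v : ℂ} {r : ℝ} (hv : ‖v‖ ≤ r) (hr : r < 1) :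
    ‖invSqrtOneSub v‖ ≤ (1 - r) ^ (-(1 / 2) : ℝ) := by
  have h0 : 1 - v ≠ 0 := Complex.slitPlane_ne_zero (one_sub_mem_slitPlane (hv.trans_lt hr))
  have h1 : 1 - r ≤ ‖1 - v‖ := by
    have := norm_sub_norm_le 1 v
    rw [norm_one] at this
    linarith
  have : invSqrtOneSub v = (1 - v) ^ ((-(1 / 2) : ℝ) : ℂ) := by
    simp [invSqrtOneSub]
  rw [this, Complex.norm_cpow_real]
  exact Real.rpow_le_rpow_of_nonpos (by linarith) h1 (by norm_num)

lemma invSqrtOneSub_ofReal {x : ℝ} (hx : x < 1) :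
    invSqrtOneSub x = ((1 / √(1 - x) : ℝ) : ℂ) := by
  rw [invSqrtOneSub, Real.sqrt_eq_rpow, one_div (_ ^ _), ← Real.rpow_neg (by linarith),
    Complex.ofReal_cpow (by linarith)]
  push_cast
  rfl

/-- `Λ` is a primitive of `(1 - p² cosh² s)^{-1/2}` on `{|p cosh s| < 1}` vanishing at the origin. -/
structure IsSlitPrimitive (p : ℝ) (Λ : ℂ → ℂ) : Prop where
  zero : Λ 0 = 0
  hasDerivAt : ∀ s, ‖(p : ℂ) * Complex.cosh s‖ < 1 →
    HasDerivAt Λ (invSqrtOneSub (((p : ℂ) * Complex.cosh s) ^ 2)) s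

lemma exists_isSlitPrimitive {p : ℝ} (hp : p ∈ Ioo (0 : ℝ) 1) : ∃ Λ, IsSlitPrimitive p Λ := by
  obtain ⟨Λ, h0, h⟩ := exists_primitive_comp (k := invSqrtOneSub)
    (φ := fun s => ((p : ℂ) * Complex.cosh s) ^ 2) (s₀ := 0) (R := p ^ 2)
    differentiableOn_invSqrtOneSub
    ((Complex.differentiable_cosh.const_mul _).pow 2) (by nlinarith [hp.1, hp.2])
    (by simp) fun ρ hρ => by
      have hρ0 : 0 < ρ := (sq_nonneg p).trans_lt hρ
      convert isPreconnected_norm_cosh_lt hp.1 (R := √ρ) (Real.lt_sqrt_of_sq_lt hρ) using 3 with s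
      rw [norm_pow, Real.lt_sqrt (norm_nonneg _)]
  exact ⟨Λ, h0, fun s hs => h s (by
    simp only [norm_pow]
    exact pow_lt_one₀ (norm_nonneg _) hs two_ne_zero)⟩

namespace IsSlitPrimitive

variable {p : ℝ} {Λ : ℂ → ℂ}

lemma norm_lt_one_of_re (hp : p ∈ Ioo (0 : ℝ) 1) {s : ℂ} (hs : s.re = 0) :
    ‖(p : ℂ) * Complex.cosh s‖ < 1 := by
  rw [norm_mul, Complex.norm_real, Real.norm_of_nonneg hp.1.le]
  exact (mul_le_of_le_one_right hp.1.le (Complex.norm_cosh_of_re_eq_zero hs)).trans_lt hp.2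

/-- Translation by `πi` changes the sign of `cosh` and the integrand depends on `cosh²`, so the
difference of the two primitives is constant on a connected set. -/
lemma add_pi_mul_I (h : IsSlitPrimitive p Λ) (hp : p ∈ Ioo (0 : ℝ) 1) {s : ℂ}
    (hs : ‖(p : ℂ) * Complex.cosh s‖ < 1) :
    Λ (s + Real.pi * Complex.I) = Λ s + Λ (Real.pi * Complex.I) := by
  have hcosh : ∀ s, Complex.cosh (s + Real.pi * Complex.I) = -Complex.cosh s := fun s => by
    simp [Complex.cosh_add, Complex.cosh_mul_I, Complex.sinh_mul_I]
  have hD : IsOpen {s : ℂ | ‖(p : ℂ) * Complex.cosh s‖ < 1} := by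
    refine isOpen_lt (Continuous.norm ?_) continuous_const
    exact continuous_const.mul Complex.continuous_cosh
  have hder : ∀ s, ‖(p : ℂ) * Complex.cosh s‖ < 1 →
      HasDerivAt (fun s => Λ (s + Real.pi * Complex.I) - Λ s) 0 s := fun s hs => by
    have h1 := h.hasDerivAt (s + Real.pi * Complex.I) (by simpa [hcosh] using hs)
    have h2 := (h1.comp_add_const s _).sub (h.hasDerivAt s hs)
    rw [hcosh, mul_neg, neg_sq, sub_self] at h2
    exact h2
  have := hD.is_const_of_deriv_eq_zero (isPreconnected_norm_cosh_lt hp.1 hp.2)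
    (fun s hs => (hder s hs).differentiableAt.differentiableWithinAt)
    (fun s hs => (hder s hs).deriv) hs (norm_lt_one_of_re hp (s := 0) rfl)
  simp only [zero_add, h.zero, sub_zero] at this
  linear_combination this

/-- On the imaginary axis the integrand is real and `ds` is imaginary. This is what gives the
uniformizer modulus one at the slit. -/
lemma re_eq_zero (h : IsSlitPrimitive p Λ) (hp : p ∈ Ioo (0 : ℝ) 1) {s : ℂ} (hs : s.re = 0) :
    (Λ s).re = 0 := by
  have hder : ∀ y : ℝ, HasDerivAt (fun y : ℝ => (Λ (y * Complex.I)).re) 0 y := fun y => by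
    have h1 := h.hasDerivAt (y * Complex.I) (norm_lt_one_of_re hp (by simp))
    have h2 : HasDerivAt (fun y : ℝ => (y : ℂ) * Complex.I) (1 * Complex.I) y :=
      (Complex.ofRealCLM.hasDerivAt (x := y)).mul_const Complex.I
    have h3 := HasDerivAt.comp_of_eq (y : ℝ) h1 h2 rfl
    have h4 := Complex.reCLM.hasFDerivAt.comp_hasDerivAt y h3
    have hlt : (p * Real.cos y) ^ 2 < 1 := by
      rw [sq_lt_one_iff_abs_lt_one, abs_mul, abs_of_pos hp.1]
      exact (mul_le_of_le_one_right hp.1.le (Real.abs_cos_le_one y)).trans_lt hp.2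
    have : ((p : ℂ) * Complex.cosh (y * Complex.I)) ^ 2 = (((p * Real.cos y) ^ 2 : ℝ) : ℂ) := by
      rw [Complex.cosh_mul_I]; push_cast; rfl
    rw [this, invSqrtOneSub_ofReal hlt] at h4
    simpa [Function.comp_def] using h4
  have hc := is_const_of_deriv_eq_zero (fun y => (hder y).differentiableAt)
    (fun y => (hder y).deriv) s.im 0
  have : s.im * Complex.I = s := by
    apply Complex.ext <;> simp [hs]
  rw [this] at hc
  simpa [h.zero] using hc

/-- On a thin strip `|p cosh s|` stays below `(p + 1)/2 < 1`, so the integrand is bounded. The mean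
value inequality then compares `s` with its projection to the imaginary axis. -/
lemma exists_abs_re_le (h : IsSlitPrimitive p Λ) (hp : p ∈ Ioo (0 : ℝ) 1) :
    ∃ C > 0, ∃ δ > 0, ∀ s : ℂ, |s.re| ≤ δ → |(Λ s).re| ≤ C * |s.re| := by
  obtain ⟨δ, hδ, hδ'⟩ : ∃ δ > 0, ∀ x : ℝ, |x| ≤ δ → p * Real.cosh x ≤ (p + 1) / 2 := by
    have hc : ContinuousAt (fun x : ℝ => p * Real.cosh x) 0 :=
      (continuous_const.mul Real.continuous_cosh).continuousAt
    have := hc.tendsto.eventually_lt_const (u := (p + 1) / 2) (by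
      rw [Real.cosh_zero]; linarith [hp.2])
    obtain ⟨δ, hδ, H⟩ := Metric.eventually_nhds_iff.1 this
    exact ⟨δ / 2, half_pos hδ, fun x hx => (H (by
      rw [Real.dist_eq, sub_zero]; linarith)).le⟩
  set r : ℝ := ((p + 1) / 2) ^ 2
  have hr : r < 1 := pow_lt_one₀ (by linarith [hp.1]) (by linarith [hp.2]) two_ne_zero
  have hb : ∀ s : ℂ, |s.re| ≤ δ → ‖(p : ℂ) * Complex.cosh s‖ ≤ (p + 1) / 2 := fun s hs => by
    rw [norm_mul, Complex.norm_real, Real.norm_of_nonneg hp.1.le]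
    exact (mul_le_mul_of_nonneg_left (Complex.norm_cosh_le_cosh_re s) hp.1.le).trans (hδ' _ hs)
  refine ⟨(1 - r) ^ (-(1 / 2) : ℝ), Real.rpow_pos_of_pos (by linarith) _, δ, hδ, fun s hs => ?_⟩
  have hconv : Convex ℝ {s : ℂ | |s.re| ≤ δ} := by
    have : {s : ℂ | |s.re| ≤ δ} = Complex.re ⁻¹' Icc (-δ) δ := by
      ext s; simp [abs_le]
    rw [this]
    exact (convex_Icc _ _).linear_preimage Complex.reLm
  have key := hconv.norm_image_sub_le_of_norm_hasDerivWithin_le (f := Λ)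
    (f' := fun s => invSqrtOneSub (((p : ℂ) * Complex.cosh s) ^ 2))
    (C := (1 - r) ^ (-(1 / 2) : ℝ)) (x := s.im * Complex.I) (y := s)
    (fun t ht => (h.hasDerivAt t ((hb t ht).trans_lt (by linarith [hp.2]))).hasDerivWithinAt)
    (fun t ht => norm_invSqrtOneSub_le (by
      rw [norm_pow]; exact pow_le_pow_left₀ (norm_nonneg _) (hb t ht) 2) hr)
    (show |(s.im * Complex.I : ℂ).re| ≤ δ by simpa using hδ.le) hs
  have h1 : (Λ (s.im * Complex.I)).re = 0 := h.re_eq_zero hp (by simp)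
  have h2 : s - s.im * Complex.I = (s.re : ℂ) := by
    apply Complex.ext <;> simp
  have h3 := Complex.abs_re_le_norm (Λ s - Λ (s.im * Complex.I))
  rw [Complex.sub_re, h1, sub_zero] at h3
  rw [h2, Complex.norm_real, Real.norm_eq_abs] at key
  exact h3.trans key

/-- Along the real axis, `Λ` is real and its derivative is `(1 - p² cosh² x)^{-1/2}`. -/
lemma hasDerivAt_re_ofReal (h : IsSlitPrimitive p Λ) (hp : p ∈ Ioo (0 : ℝ) 1) {x : ℝ}
    (hx : p * Real.cosh x < 1) :
    HasDerivAt (fun x : ℝ => (Λ x).re) (1 / √(1 - (p * Real.cosh x) ^ 2)) x := by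
  have hpos : 0 < p * Real.cosh x := mul_pos hp.1 (Real.cosh_pos x)
  have h1 := (h.hasDerivAt (x : ℂ) (by
    rw [← Complex.ofReal_cosh, ← Complex.ofReal_mul, Complex.norm_real,
      Real.norm_of_nonneg hpos.le]
    exact hx)).real_of_complex
  convert h1 using 1
  have hlt : (p * Real.cosh x) ^ 2 < 1 := pow_lt_one₀ hpos.le hx two_ne_zero
  have : ((p : ℂ) * Complex.cosh x) ^ 2 = (((p * Real.cosh x) ^ 2 : ℝ) : ℂ) := by
    push_cast; rfl
  rw [this, invSqrtOneSub_ofReal hlt, Complex.ofReal_re]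

end IsSlitPrimitive

/-! ### The slit, the angular integral and the lift `L cosh s = e^u`. -/

/-- The closed interval `[-L, L]` in the complex plane. -/
def slit (L : ℝ) : Set ℂ := (fun t : ℝ => (t : ℂ)) '' Icc (-L) L

lemma isCompact_slit (L : ℝ) : IsCompact (slit L) :=
  isCompact_Icc.image Complex.continuous_ofReal

lemma norm_le_of_mem_slit {L : ℝ} {w : ℂ} (hw : w ∈ slit L) : ‖w‖ ≤ L := by
  obtain ⟨t, ht, rfl⟩ := hw
  simpa [Complex.norm_real, abs_le] using ht

/-- The integral `∫₀^θ dφ / |1 - p e^{2iφ}|`. -/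
noncomputable def angularInt (p θ : ℝ) : ℝ :=
  ∫ φ in (0 : ℝ)..θ, 1 / ‖1 - (p : ℂ) * Complex.exp (2 * (φ * Complex.I))‖

lemma one_sub_mul_exp_ne_zero {p : ℝ} (hp : p ∈ Ioo (0 : ℝ) 1) (φ : ℝ) :
    1 - (p : ℂ) * Complex.exp (2 * (φ * Complex.I)) ≠ 0 := by
  refine Complex.slitPlane_ne_zero (one_sub_mem_slitPlane ?_)
  rw [norm_mul, Complex.norm_real, Complex.norm_exp, Real.norm_of_nonneg hp.1.le]
  simpa using hp.2

lemma continuous_angularInt_integrand {p : ℝ} (hp : p ∈ Ioo (0 : ℝ) 1) :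
    Continuous fun φ : ℝ => 1 / ‖1 - (p : ℂ) * Complex.exp (2 * (φ * Complex.I))‖ :=
  continuous_const.div (by fun_prop) fun φ => norm_ne_zero_iff.2 (one_sub_mul_exp_ne_zero hp φ)

lemma hasDerivAt_angularInt {p : ℝ} (hp : p ∈ Ioo (0 : ℝ) 1) (θ : ℝ) :
    HasDerivAt (angularInt p) (1 / ‖1 - (p : ℂ) * Complex.exp (2 * (θ * Complex.I))‖) θ :=
  (continuous_angularInt_integrand hp).integral_hasStrictDerivAt 0 θ |>.hasDerivAt

@[simp] lemma angularInt_zero (p : ℝ) : angularInt p 0 = 0 := by simp [angularInt]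

lemma strictMono_angularInt {p : ℝ} (hp : p ∈ Ioo (0 : ℝ) 1) : StrictMono (angularInt p) :=
  strictMono_of_hasDerivAt_pos (hasDerivAt_angularInt hp) fun θ =>
    one_div_pos.2 (norm_pos_iff.2 (one_sub_mul_exp_ne_zero hp θ))

/-- The mean value of the integrand of `angularInt`. -/
noncomputable def angularMean (p : ℝ) : ℝ := angularInt p Real.pi / Real.pi

lemma angularMean_pos {p : ℝ} (hp : p ∈ Ioo (0 : ℝ) 1) : 0 < angularMean p := by
  have := strictMono_angularInt hp Real.pi_pos
  rw [angularInt_zero] at this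
  exact div_pos this Real.pi_pos

/-- The square root of `1 - L² / w²` at `w = e^u`. -/
noncomputable def slitRoot (L : ℝ) (u : ℂ) : ℂ := (1 - (L * Complex.exp (-u)) ^ 2) ^ (1 / 2 : ℂ)

/-- A solution `s` of `L cosh s = e^u`. -/
noncomputable def slitLift (L : ℝ) (u : ℂ) : ℂ := u - Real.log L + Complex.log (1 + slitRoot L u)

lemma re_cpow_half_nonneg (z : ℂ) : 0 ≤ (z ^ (1 / 2 : ℂ)).re := by
  by_cases hz : z = 0
  · simp [hz]
  rw [Complex.cpow_def_of_ne_zero hz, Complex.exp_re]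
  refine mul_nonneg (Real.exp_pos _).le (Real.cos_nonneg_of_neg_pi_div_two_le_of_le ?_ ?_)
  · have := Complex.neg_pi_lt_arg z
    simp [Complex.mul_im, Complex.log_im]
    linarith
  · have := Complex.arg_le_pi z
    simp [Complex.mul_im, Complex.log_im]
    linarith

section Lift

variable {L : ℝ} {u : ℂ}

/-- The number `1 - (L/w)²` is real and nonpositive only if `L/w` is real of modulus at least one,
which places `w` on the slit. The principal root is therefore holomorphic off the slit. -/
lemma slitRoot_arg_mem_slitPlane (hL : 0 < L) (hu : Complex.exp u ∉ slit L) :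
    1 - ((L : ℂ) * Complex.exp (-u)) ^ 2 ∈ Complex.slitPlane := by
  by_contra hcon
  set v := (L : ℂ) * Complex.exp (-u) with hv
  rw [Complex.mem_slitPlane_iff, not_or, not_lt, not_not] at hcon
  simp only [Complex.sub_re, Complex.one_re, Complex.sub_im, Complex.one_im, sq, Complex.mul_re,
    Complex.mul_im] at hcon
  obtain ⟨h1, h2⟩ := hcon
  have him : v.im = 0 := by
    have : v.re * v.im = 0 := by linarith
    rcases mul_eq_zero.1 this with h | h
    · rw [h] at h1
      nlinarith [mul_self_nonneg v.im]
    · exact h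
  rw [him] at h1
  have hre : 1 ≤ |v.re| := by
    rw [← sq_le_sq₀ zero_le_one (abs_nonneg _), sq_abs]
    nlinarith
  have hvr : v = (v.re : ℂ) := by apply Complex.ext <;> simp [him]
  apply hu
  refine ⟨L / v.re, ?_, ?_⟩
  · rw [mem_Icc, ← abs_le, abs_div, abs_of_pos hL]
    exact div_le_self hL.le hre
  · have hv0 : v ≠ 0 := mul_ne_zero (by exact_mod_cast hL.ne') (Complex.exp_ne_zero _)
    have : Complex.exp u * v = L := by
      rw [hv, mul_left_comm, ← Complex.exp_add]; simp
    simp only [Complex.ofReal_div]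
    rw [← hvr, ← this, mul_div_cancel_right₀ _ hv0]

lemma slitRoot_sq : slitRoot L u ^ 2 = 1 - (L * Complex.exp (-u)) ^ 2 := by
  rw [slitRoot, one_div]
  exact_mod_cast Complex.cpow_nat_inv_pow _ two_ne_zero

lemma slitRoot_ne_zero (hL : 0 < L) (hu : Complex.exp u ∉ slit L) : slitRoot L u ≠ 0 := fun h => by
  have := slitRoot_sq (L := L) (u := u)
  rw [h, zero_pow two_ne_zero] at this
  exact Complex.slitPlane_ne_zero (slitRoot_arg_mem_slitPlane hL hu) this.symm

lemma one_add_slitRoot_mem_slitPlane : 1 + slitRoot L u ∈ Complex.slitPlane := by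
  refine Or.inl ?_
  have := re_cpow_half_nonneg (1 - ((L : ℂ) * Complex.exp (-u)) ^ 2)
  rw [← slitRoot] at this
  simp only [Complex.add_re, Complex.one_re]
  linarith

lemma exp_slitLift (hL : 0 < L) :
    Complex.exp (slitLift L u) = Complex.exp u / L * (1 + slitRoot L u) := by
  rw [slitLift, Complex.exp_add, Complex.exp_sub, ← Complex.ofReal_exp, Real.exp_log hL,
    Complex.exp_log (Complex.slitPlane_ne_zero one_add_slitRoot_mem_slitPlane)]

/-- With `r² = 1 - (L/w)²`, the numbers `(w/L)(1 + r)` and `(w/L)(1 - r)` have product one and sum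
`2w/L`, so they are `e^s` and `e^{-s}`. -/
lemma mul_cosh_slitLift (hL : 0 < L) : (L : ℂ) * Complex.cosh (slitLift L u) = Complex.exp u := by
  have hL' : (L : ℂ) ≠ 0 := by exact_mod_cast hL.ne'
  have h1 := Complex.slitPlane_ne_zero (one_add_slitRoot_mem_slitPlane (L := L) (u := u))
  have h2 := slitRoot_sq (L := L) (u := u)
  have h3 := Complex.exp_ne_zero u
  rw [Complex.cosh, Complex.exp_neg, exp_slitLift hL]
  rw [Complex.exp_neg] at h2
  field_simp at h2 ⊢
  linear_combination h2

lemma hasDerivAt_slitLift (hL : 0 < L) (hu : Complex.exp u ∉ slit L) :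
    HasDerivAt (slitLift L) (1 / slitRoot L u) u := by
  have hr := slitRoot_ne_zero hL hu
  have h1 := Complex.slitPlane_ne_zero (one_add_slitRoot_mem_slitPlane (L := L) (u := u))
  have hm := slitRoot_arg_mem_slitPlane hL hu
  have hv : HasDerivAt (fun u => 1 - ((L : ℂ) * Complex.exp (-u)) ^ 2)
      (2 * (L * Complex.exp (-u)) ^ 2) u := by
    have := (((hasDerivAt_neg u).cexp.const_mul (L : ℂ)).pow 2).const_sub 1
    refine this.congr_deriv ?_
    simp; ring
  have hroot : HasDerivAt (slitRoot L) ((L * Complex.exp (-u)) ^ 2 / slitRoot L u) u := by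
    have := hv.cpow_const (c := (1 / 2 : ℂ)) hm
    refine this.congr_deriv ?_
    have h0 := Complex.slitPlane_ne_zero hm
    rw [Complex.cpow_sub _ _ h0, Complex.cpow_one, ← slitRoot, ← slitRoot_sq]
    field_simp
  have hlog := (hroot.const_add 1).clog one_add_slitRoot_mem_slitPlane
  have := ((hasDerivAt_id u).sub_const (Real.log L : ℂ)).add hlog
  refine this.congr_deriv ?_
  have h2 := slitRoot_sq (L := L) (u := u)
  have h2' : ((L : ℂ) * Complex.exp (-u)) ^ 2 = 1 - slitRoot L u ^ 2 := by
    linear_combination h2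
  rw [h2']
  field_simp
  ring

lemma slitLift_add_pi_mul_I :
    slitLift L (u + Real.pi * Complex.I) = slitLift L u + Real.pi * Complex.I := by
  have : slitRoot L (u + Real.pi * Complex.I) = slitRoot L u := by
    have h : Complex.exp (-(u + Real.pi * Complex.I)) = -Complex.exp (-u) := by
      rw [neg_add, Complex.exp_add, Complex.exp_neg (_ * _), Complex.exp_pi_mul_I]
      ring
    rw [slitRoot, slitRoot, h, mul_neg, neg_sq]
  rw [slitLift, slitLift, this]
  ring

/-- Ellipse identity with foci `±1`: `|cosh s - 1| + |cosh s + 1| = 2 cosh(Re s)`. If `t` is a point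
of the slit nearest to `w = L cosh s`, then `L` times the left side is at most `2ε + (L - t) + (L +
t)`. -/
lemma cosh_re_slitLift_le (hL : 0 < L) {w : ℂ} {ε : ℝ} (hw : Complex.exp u = w)
    (hd : Metric.infDist w (slit L) ≤ ε) :
    Real.cosh (slitLift L u).re ≤ 1 + ε / L := by
  set s := slitLift L u with hs
  have hcosh := mul_cosh_slitLift (u := u) hL
  rw [← hs, hw] at hcosh
  obtain ⟨y, ⟨t, ht, rfl⟩, hy⟩ := (isCompact_slit L).exists_infDist_eq_dist
    (⟨_, ⟨0, ⟨by linarith, hL.le⟩, rfl⟩⟩ : (slit L).Nonempty) w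
  have hyε : ‖w - t‖ ≤ ε := by rw [← dist_eq_norm, ← hy]; exact hd
  have hid : ∀ σ : ℝ, σ ^ 2 = 1 → ‖Complex.cosh s - σ‖ = Real.cosh s.re - σ * Real.cos s.im := by
    intro σ hσ
    have hc : Complex.cosh s - σ = (Real.cosh s.re * Real.cos s.im - σ : ℝ) +
        (Real.sinh s.re * Real.sin s.im : ℝ) * Complex.I := by
      conv_lhs => rw [← Complex.re_add_im s]
      rw [Complex.cosh_add, Complex.cosh_mul_I, Complex.sinh_mul_I]
      push_cast
      ring
    have hnn : 0 ≤ Real.cosh s.re - σ * Real.cos s.im := by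
      have h1 := Real.one_le_cosh s.re
      have h2 : |σ * Real.cos s.im| ≤ 1 := by
        rw [abs_mul, ← Real.sqrt_sq_eq_abs σ, hσ, Real.sqrt_one]
        simpa using Real.abs_cos_le_one s.im
      linarith [(abs_le.1 h2).2]
    rw [← sq_eq_sq₀ (norm_nonneg _) hnn, hc, Complex.sq_norm, Complex.normSq_add_mul_I]
    have h1 := Real.cosh_sq s.re
    have h2 := Real.sin_sq_add_cos_sq s.im
    linear_combination (Real.cos s.im ^ 2 - 1) * h1 + Real.sinh s.re ^ 2 * h2 +
      (1 - Real.cos s.im ^ 2) * hσ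
  have h1 := hid 1 (by norm_num)
  have h2 := hid (-1) (by norm_num)
  have hLn : ‖(L : ℂ)‖ = L := by simp [abs_of_pos hL]
  have hb : ∀ σ : ℝ, L * ‖Complex.cosh s - σ‖ ≤ ε + |t - L * σ| := fun σ => by
    have : (L : ℂ) * (Complex.cosh s - σ) = (w - t) + ((t - L * σ : ℝ) : ℂ) := by
      rw [mul_sub, hcosh]; push_cast; ring
    rw [← hLn, ← norm_mul, this]
    refine (norm_add_le _ _).trans ?_
    rw [Complex.norm_real, hLn, Real.norm_eq_abs]
    linarith
  have h3 := hb 1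
  have h4 := hb (-1)
  rw [h1, abs_of_nonpos (by linarith [ht.2])] at h3
  rw [h2, abs_of_nonneg (by linarith [ht.1])] at h4
  rw [← sub_le_iff_le_add', le_div_iff₀ hL]
  nlinarith

end Lift

/-! ### The uniformizer of the slit disk. -/

/-- A holomorphic function on `{|w| < 1/L} \ [-L, L]` of constant norm `1` on the slit and of constant
norm `ρ` on the unit circle, of winding number one around the slit. -/
structure IsSlitUniformizer (L ρ : ℝ) (G : ℂ → ℂ) : Prop where
  differentiableAt : ∀ w : ℂ, L * ‖w‖ < 1 → w ∉ slit L → DifferentiableAt ℂ G w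
  ne_zero : ∀ w, G w ≠ 0
  circle : ∀ θ : ℝ, G (Complex.exp (θ * Complex.I)) =
    G 1 * Complex.exp ((angularInt (L ^ 2) θ / angularMean (L ^ 2) : ℝ) * Complex.I)
  norm_one : ‖G 1‖ = ρ
  deriv_circle : ∀ θ : ℝ, HasDerivAt G (G (Complex.exp (θ * Complex.I)) /
    (Complex.exp (θ * Complex.I) * (angularMean (L ^ 2) *
      ‖1 - ((L ^ 2 : ℝ) : ℂ) * Complex.exp (2 * (θ * Complex.I))‖ : ℝ)))
      (Complex.exp (θ * Complex.I))
  winding : ∀ r ∈ Ioo L 1, ∃ γ : ℝ → ℂ, Continuous γ ∧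
    (∀ θ : ℝ, G (r * Complex.exp (θ * Complex.I)) = Complex.exp (γ θ)) ∧
    γ (2 * Real.pi) = γ 0 + 2 * Real.pi * Complex.I
  norm_near_slit : ∀ ε > 0, ∃ δ > 0, ∀ w : ℂ, L * ‖w‖ < 1 → w ∉ slit L →
    Metric.infDist w (slit L) < δ → |‖G w‖ - 1| < ε

/-- The part of the logarithm cover on which the lifted uniformizer lives. -/
def slitCover (L : ℝ) : Set ℂ := {u | L * ‖Complex.exp u‖ < 1 ∧ Complex.exp u ∉ slit L}

section Lifted

variable {L : ℝ} {Λ : ℂ → ℂ} {u : ℂ}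

lemma sq_mem_Ioo (hL : L ∈ Ioo (0 : ℝ) 1) : L ^ 2 ∈ Ioo (0 : ℝ) 1 :=
  ⟨pow_pos hL.1 2, pow_lt_one₀ hL.1.le hL.2 two_ne_zero⟩

lemma mul_norm_lt_one_of_norm_le_one (hL : L ∈ Ioo (0 : ℝ) 1) {w : ℂ} (hw : ‖w‖ ≤ 1) :
    L * ‖w‖ < 1 := (mul_le_of_le_one_right hL.1.le hw).trans_lt hL.2

lemma mem_slitCover_of_re (hL : L ∈ Ioo (0 : ℝ) 1) (h1 : L < Real.exp u.re) (h2 : u.re ≤ 0) :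
    u ∈ slitCover L := by
  refine ⟨mul_norm_lt_one_of_norm_le_one hL ?_, fun h => ?_⟩
  · rw [Complex.norm_exp]; exact Real.exp_le_one_iff.2 h2
  · have := norm_le_of_mem_slit h
    rw [Complex.norm_exp] at this
    exact absurd this (not_le.2 h1)

lemma mul_cosh_slitLift_sq (hL : 0 < L) :
    ((L ^ 2 : ℝ) : ℂ) * Complex.cosh (slitLift L u) = L * Complex.exp u := by
  rw [← mul_cosh_slitLift hL]; push_cast; ring

lemma norm_mul_cosh_slitLift_lt (hL : 0 < L) (hu : u ∈ slitCover L) :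
    ‖((L ^ 2 : ℝ) : ℂ) * Complex.cosh (slitLift L u)‖ < 1 := by
  rw [mul_cosh_slitLift_sq hL, norm_mul, Complex.norm_real, Real.norm_of_nonneg hL.le]
  exact hu.1

lemma hasDerivAt_comp_slitLift (h : IsSlitPrimitive (L ^ 2) Λ) (hL : 0 < L)
    (hu : u ∈ slitCover L) :
    HasDerivAt (fun u => Λ (slitLift L u))
      (invSqrtOneSub ((L * Complex.exp u) ^ 2) * (1 / slitRoot L u)) u := by
  have := (h.hasDerivAt _ (norm_mul_cosh_slitLift_lt hL hu)).comp u (hasDerivAt_slitLift hL hu.2)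
  rwa [mul_cosh_slitLift_sq hL] at this

/-- For `|w| = 1` the numbers `1 - L² w²` and `1 - L² w⁻²` are conjugate, so the product of their
inverse roots is positive. This symmetry is the reason for taking `p = L²`. -/
lemma invSqrtOneSub_mul_slitRoot_circle (hL : L ∈ Ioo (0 : ℝ) 1) (θ : ℝ) :
    invSqrtOneSub ((L * Complex.exp (θ * Complex.I)) ^ 2) * (1 / slitRoot L (θ * Complex.I)) =
      ((1 / ‖1 - ((L ^ 2 : ℝ) : ℂ) * Complex.exp (2 * (θ * Complex.I))‖ : ℝ) : ℂ) := by
  set z : ℂ := 1 - ((L ^ 2 : ℝ) : ℂ) * Complex.exp (2 * (θ * Complex.I)) with hz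
  have hzs : z ∈ Complex.slitPlane := by
    refine one_sub_mem_slitPlane ?_
    rw [norm_mul, Complex.norm_real, Complex.norm_exp, Real.norm_of_nonneg (sq_nonneg L)]
    simpa using (sq_mem_Ioo hL).2
  have h1 : 1 - ((L : ℂ) * Complex.exp (θ * Complex.I)) ^ 2 = z := by
    rw [hz, two_mul, Complex.exp_add]; push_cast; ring
  have h2 : 1 - ((L : ℂ) * Complex.exp (-(θ * Complex.I))) ^ 2 = (starRingEnd ℂ) z := by
    rw [← h1]
    simp [← Complex.exp_conj]
  have harg : z.arg ≠ Real.pi := Complex.slitPlane_arg_ne_pi hzs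
  have hh : (starRingEnd ℂ) (1 / 2 : ℂ) = 1 / 2 := by
    rw [map_div₀, map_one, map_ofNat]
  have h3 : ((starRingEnd ℂ) z) ^ (1 / 2 : ℂ) = (starRingEnd ℂ) (z ^ (1 / 2 : ℂ)) := by
    rw [Complex.conj_cpow _ _ harg, hh]
  rw [invSqrtOneSub, slitRoot, h1, h2, h3, Complex.cpow_neg, one_div (starRingEnd ℂ _), ← mul_inv, Complex.mul_conj]
  have h4 : Complex.normSq (z ^ (1 / 2 : ℂ)) = ‖z‖ := by
    rw [← Complex.sq_norm, ← norm_pow, one_div]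
    congr 1
    exact_mod_cast Complex.cpow_nat_inv_pow z two_ne_zero
  rw [h4]; push_cast; ring

lemma mem_slitCover_mul_I (hL : L ∈ Ioo (0 : ℝ) 1) (θ : ℝ) :
    (θ * Complex.I : ℂ) ∈ slitCover L :=
  mem_slitCover_of_re hL (by simpa using hL.2) (by simp)

lemma comp_slitLift_mul_I (h : IsSlitPrimitive (L ^ 2) Λ) (hL : L ∈ Ioo (0 : ℝ) 1) (θ : ℝ) :
    Λ (slitLift L (θ * Complex.I)) = Λ (slitLift L 0) + angularInt (L ^ 2) θ * Complex.I := by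
  have hder : ∀ θ : ℝ, HasDerivAt (fun θ : ℝ =>
      Λ (slitLift L (θ * Complex.I)) - angularInt (L ^ 2) θ * Complex.I) 0 θ := fun θ => by
    have h1 := hasDerivAt_comp_slitLift h hL.1 (mem_slitCover_mul_I hL θ)
    rw [invSqrtOneSub_mul_slitRoot_circle hL] at h1
    have h2 : HasDerivAt (fun y : ℝ => (y : ℂ) * Complex.I) (1 * Complex.I) θ :=
      (Complex.ofRealCLM.hasDerivAt (x := θ)).mul_const Complex.I
    have h3 := HasDerivAt.comp_of_eq (θ : ℝ) h1 h2 rfl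
    have h4 := ((hasDerivAt_angularInt (sq_mem_Ioo hL) θ).ofReal_comp).mul_const Complex.I
    refine (h3.sub h4).congr_deriv ?_
    rw [one_mul, sub_self]
  have := is_const_of_deriv_eq_zero (fun y => (hder y).differentiableAt)
    (fun y => (hder y).deriv) θ 0
  simp only [angularInt_zero, Complex.ofReal_zero, zero_mul, sub_zero] at this
  linear_combination this

/-- The increment of `Λ` over a half turn of the circle is computed twice, by translation of the
lift and by the angular integral. -/
lemma primitive_pi_mul_I (h : IsSlitPrimitive (L ^ 2) Λ) (hL : L ∈ Ioo (0 : ℝ) 1) :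
    Λ (Real.pi * Complex.I) = angularMean (L ^ 2) * (Real.pi * Complex.I) := by
  have h1 := comp_slitLift_mul_I h hL Real.pi
  have h2 := slitLift_add_pi_mul_I (L := L) (u := 0)
  rw [zero_add] at h2
  have h0 : (0 : ℂ) ∈ slitCover L := by simpa using mem_slitCover_mul_I hL 0
  rw [h2, h.add_pi_mul_I (sq_mem_Ioo hL) (norm_mul_cosh_slitLift_lt hL.1 h0)] at h1
  rw [add_left_cancel h1, angularMean]
  have : (Real.pi : ℂ) ≠ 0 := by exact_mod_cast Real.pi_ne_zero
  push_cast
  field_simp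

/-- The lifted uniformizer. -/
noncomputable def liftedUniformizer (L : ℝ) (Λ : ℂ → ℂ) (u : ℂ) : ℂ :=
  Λ (slitLift L u) / angularMean (L ^ 2)

lemma slitCover_add_int {n : ℤ} (hu : u ∈ slitCover L) :
    u + n * (2 * Real.pi * Complex.I) ∈ slitCover L := by
  rw [slitCover, mem_ofPred_eq, Complex.exp_periodic.int_mul n u]
  exact hu

lemma liftedUniformizer_add_two_pi (h : IsSlitPrimitive (L ^ 2) Λ) (hL : L ∈ Ioo (0 : ℝ) 1)
    (hu : u ∈ slitCover L) : liftedUniformizer L Λ (u + 2 * Real.pi * Complex.I) =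
      liftedUniformizer L Λ u + 2 * Real.pi * Complex.I := by
  have hκ : (angularMean (L ^ 2) : ℂ) ≠ 0 := by
    exact_mod_cast (angularMean_pos (sq_mem_Ioo hL)).ne'
  have hstep : ∀ u, u ∈ slitCover L → liftedUniformizer L Λ (u + Real.pi * Complex.I) =
      liftedUniformizer L Λ u + Real.pi * Complex.I := fun u hu => by
    rw [liftedUniformizer, slitLift_add_pi_mul_I, h.add_pi_mul_I (sq_mem_Ioo hL)
      (norm_mul_cosh_slitLift_lt hL.1 hu), primitive_pi_mul_I h hL, add_div,
      mul_div_cancel_left₀ _ hκ, liftedUniformizer]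
  have hu' : u + Real.pi * Complex.I ∈ slitCover L := by
    have hneg : ∀ w : ℂ, -w ∈ slit L → w ∈ slit L := by
      rintro w ⟨t, ht, hw⟩
      exact ⟨-t, ⟨by linarith [ht.2], by linarith [ht.1]⟩, by
        simp only at hw; simp [hw]⟩
    refine ⟨?_, fun hmem => hu.2 (hneg _ ?_)⟩
    · rw [Complex.exp_add, Complex.exp_pi_mul_I, mul_neg_one, norm_neg]; exact hu.1
    · rwa [Complex.exp_add, Complex.exp_pi_mul_I, mul_neg_one] at hmem
  have h2 : u + 2 * Real.pi * Complex.I = u + Real.pi * Complex.I + Real.pi * Complex.I := by ring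
  rw [h2, hstep _ hu', hstep _ hu]
  ring

lemma liftedUniformizer_add_int (h : IsSlitPrimitive (L ^ 2) Λ) (hL : L ∈ Ioo (0 : ℝ) 1)
    (hu : u ∈ slitCover L) (n : ℤ) :
    liftedUniformizer L Λ (u + n * (2 * Real.pi * Complex.I)) =
      liftedUniformizer L Λ u + n * (2 * Real.pi * Complex.I) := by
  induction n using Int.induction_on with
  | zero => simp
  | succ k ih =>
    have := liftedUniformizer_add_two_pi h hL (slitCover_add_int (n := (k : ℤ)) hu)
    rw [ih] at this
    convert this using 1
    · congr 1; push_cast; ring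
    · push_cast; ring
  | pred k ih =>
    have := liftedUniformizer_add_two_pi h hL (slitCover_add_int (n := -(k : ℤ) - 1) hu)
    have he : u + ((-(k : ℤ) - 1 : ℤ) : ℂ) * (2 * Real.pi * Complex.I) + 2 * Real.pi * Complex.I =
        u + ((-(k : ℤ) : ℤ) : ℂ) * (2 * Real.pi * Complex.I) := by
      push_cast; ring
    rw [he, ih] at this
    push_cast at this ⊢
    linear_combination -this

/-- The uniformizer of the slit disk. -/
noncomputable def slitUniformizer (L : ℝ) (Λ : ℂ → ℂ) (w : ℂ) : ℂ :=
  Complex.exp (liftedUniformizer L Λ (Complex.log w))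

/-- The lifted map commutes with translation by `2πi`, so its exponential does not depend on the
chosen logarithm and the cut of `Complex.log` is invisible. -/
lemma slitUniformizer_exp (h : IsSlitPrimitive (L ^ 2) Λ) (hL : L ∈ Ioo (0 : ℝ) 1)
    (hu : u ∈ slitCover L) :
    slitUniformizer L Λ (Complex.exp u) = Complex.exp (liftedUniformizer L Λ u) := by
  obtain ⟨n, hn⟩ := Complex.exp_eq_exp_iff_exists_int.1 (Complex.exp_log (Complex.exp_ne_zero u))
  rw [slitUniformizer, hn, liftedUniformizer_add_int h hL hu, Complex.exp_periodic.int_mul n]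

lemma hasDerivAt_slitUniformizer (h : IsSlitPrimitive (L ^ 2) Λ) (hL : L ∈ Ioo (0 : ℝ) 1)
    (hu : u ∈ slitCover L) :
    HasDerivAt (slitUniformizer L Λ) (slitUniformizer L Λ (Complex.exp u) / (Complex.exp u *
      (angularMean (L ^ 2) / (invSqrtOneSub ((L * Complex.exp u) ^ 2) * (1 / slitRoot L u)))))
      (Complex.exp u) := by
  set w₀ := Complex.exp u with hw₀
  have hw0 : w₀ ≠ 0 := Complex.exp_ne_zero u
  -- A branch of the logarithm near `w₀` with value `u` there, which also covers `w₀` on the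
  -- negative axis.
  set b : ℂ → ℂ := fun w => u + Complex.log (w / w₀) with hb
  have hbw : b w₀ = u := by simp [hb, div_self hw0]
  have hbd : HasDerivAt b (1 / w₀) w₀ := by
    have h1 : HasDerivAt (fun w => w / w₀) (1 / w₀) w₀ := (hasDerivAt_id w₀).div_const w₀
    have h2 := (h1.clog (by rw [div_self hw0]; exact Or.inl (by simp))).const_add u
    refine h2.congr_deriv ?_
    rw [div_self hw0, div_one]
  have hbe : ∀ w, w ≠ 0 → Complex.exp (b w) = w := fun w hw => by
    rw [hb]
    simp only
    rw [Complex.exp_add, Complex.exp_log (div_ne_zero hw hw0), ← hw₀, mul_div_cancel₀ _ hw0]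
  have hev : slitUniformizer L Λ =ᶠ[𝓝 w₀] fun w => Complex.exp (liftedUniformizer L Λ (b w)) := by
    have hopen : IsOpen {w : ℂ | L * ‖w‖ < 1 ∧ w ∉ slit L} :=
      
      (isOpen_lt (continuous_const.mul continuous_norm) continuous_const).and
        (isCompact_slit L).isClosed.isOpen_compl
    filter_upwards [hopen.mem_nhds hu, isOpen_ne.mem_nhds hw0] with w hw hw'
    rw [← slitUniformizer_exp h hL (u := b w), hbe w hw']
    show L * ‖Complex.exp (b w)‖ < 1 ∧ Complex.exp (b w) ∉ slit L
    rw [hbe w hw']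
    exact hw
  have h1 := (hasDerivAt_comp_slitLift h hL.1 hu).div_const (angularMean (L ^ 2) : ℂ)
  have h2 := (HasDerivAt.comp_of_eq w₀ h1 hbd hbw.symm).cexp
  refine (h2.congr_of_eventuallyEq hev).congr_deriv ?_
  have h3 : slitUniformizer L Λ w₀ = Complex.exp (Λ (slitLift L u) / angularMean (L ^ 2)) :=
    slitUniformizer_exp h hL hu
  simp only [Function.comp_apply, hbw]
  rw [h3, div_mul_eq_div_mul_one_div _ w₀, one_div (_ / _), inv_div]
  ring

end Lifted

/-! ### The two boundary moduli of the uniformizer. -/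

/-- The integrand times `p cosh x` is the derivative of `arcsin(p sinh x / √(1 - p²))`, and `p ≤ p
cosh x ≤ L` on `[0, x₀]`. Integration traps `Re Λ(x₀)`, an elliptic integral, between elementary
bounds. -/
lemma IsSlitPrimitive.re_ofReal_bounds {L : ℝ} {Λ : ℂ → ℂ} (h : IsSlitPrimitive (L ^ 2) Λ)
    (hL : L ∈ Ioo (0 : ℝ) 1) {x₀ : ℝ} (hx₀ : 0 ≤ x₀) (hcosh : L * Real.cosh x₀ = 1) :
    L ^ 2 * (Λ x₀).re ≤ Real.arcsin (L / √(1 + L ^ 2)) ∧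
      Real.arcsin (L / √(1 + L ^ 2)) ≤ L * (Λ x₀).re := by
  set p := L ^ 2 with hp
  have hpI : p ∈ Ioo (0 : ℝ) 1 := sq_mem_Ioo hL
  have hcx : ∀ x ∈ Icc 0 x₀, L * Real.cosh x ≤ 1 := fun x hx => by
    rw [← hcosh]
    refine mul_le_mul_of_nonneg_left (Real.cosh_le_cosh.2 ?_) hL.1.le
    rw [abs_of_nonneg hx.1, abs_of_nonneg hx₀]; exact hx.2
  have hpc : ∀ x ∈ Icc 0 x₀, p * Real.cosh x ≤ L := fun x hx => by
    have := mul_le_mul_of_nonneg_left (hcx x hx) hL.1.le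
    rw [hp]; linarith
  have hppos : 0 < 1 - p ^ 2 := by nlinarith [hpI.1, hpI.2]
  set A := √(1 - p ^ 2) with hA
  have hA0 : 0 < A := Real.sqrt_pos.2 hppos
  have hAsq : A ^ 2 = 1 - p ^ 2 := Real.sq_sqrt hppos.le
  have hΛ : ∀ x ∈ Icc 0 x₀, HasDerivAt (fun x : ℝ => (Λ x).re)
      (1 / √(1 - (p * Real.cosh x) ^ 2)) x := fun x hx =>
    h.hasDerivAt_re_ofReal hpI ((hpc x hx).trans_lt hL.2)
  have hH : ∀ x ∈ Icc 0 x₀, HasDerivAt (fun x : ℝ => Real.arcsin (p * Real.sinh x / A))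
      (p * Real.cosh x * (1 / √(1 - (p * Real.cosh x) ^ 2))) x := fun x hx => by
    have hs0 : 0 ≤ p * Real.sinh x / A :=
      div_nonneg (mul_nonneg hpI.1.le (Real.sinh_nonneg_iff.2 hx.1)) hA0.le
    have hc1 : (p * Real.cosh x) ^ 2 < 1 :=
      pow_lt_one₀ (mul_nonneg hpI.1.le (Real.cosh_pos x).le) ((hpc x hx).trans_lt hL.2) two_ne_zero
    have hid : A ^ 2 - (p * Real.sinh x) ^ 2 = 1 - (p * Real.cosh x) ^ 2 := by
      rw [hAsq, mul_pow, mul_pow, Real.cosh_sq]; ring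
    have hs1 : p * Real.sinh x / A < 1 := by
      rw [div_lt_one hA0]
      refine lt_of_pow_lt_pow_left₀ 2 hA0.le ?_
      linarith
    have h1 := (Real.hasDerivAt_arcsin (by linarith) hs1.ne).comp x
      (((Real.hasDerivAt_sinh x).const_mul p).div_const A)
    refine h1.congr_deriv ?_
    have h2 : √(1 - (p * Real.sinh x / A) ^ 2) = √(1 - (p * Real.cosh x) ^ 2) / A := by
      rw [← hid, ← Real.sqrt_sq hA0.le, ← Real.sqrt_div' _ (sq_nonneg _), Real.sqrt_sq hA0.le]
      congr 1
      field_simp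
    rw [h2]
    field_simp
  have hval : Real.arcsin (p * Real.sinh x₀ / A) = Real.arcsin (L / √(1 + L ^ 2)) := by
    congr 1
    have h1 : 0 < √(1 + L ^ 2) := Real.sqrt_pos.2 (by positivity)
    have hs : 0 ≤ Real.sinh x₀ := Real.sinh_nonneg_iff.2 hx₀
    rw [← sq_eq_sq₀ (div_nonneg (mul_nonneg hpI.1.le hs) hA0.le) (div_nonneg hL.1.le h1.le),
      div_pow, div_pow, hAsq, Real.sq_sqrt (by positivity), div_eq_div_iff hppos.ne'
      (by positivity), mul_pow, Real.sinh_sq, hp]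
    have h3 : L ^ 2 * Real.cosh x₀ ^ 2 = 1 := by rw [← mul_pow, hcosh, one_pow]
    linear_combination L ^ 2 * (1 + L ^ 2) * h3
  have mono : ∀ {F F' : ℝ → ℝ}, (∀ x ∈ Icc 0 x₀, HasDerivAt F (F' x) x) →
      (∀ x ∈ Icc 0 x₀, 0 ≤ F' x) → F 0 ≤ F x₀ := fun {F F'} hF hF' => by
    refine monotoneOn_of_hasDerivWithinAt_nonneg (convex_Icc 0 x₀)
      (fun x hx => (hF x hx).continuousAt.continuousWithinAt)
      (fun x hx => (hF x (interior_subset hx)).hasDerivWithinAt)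
      (fun x hx => hF' x (interior_subset hx)) (left_mem_Icc.2 hx₀) (right_mem_Icc.2 hx₀) hx₀
  have hnn : ∀ x, 0 ≤ 1 / √(1 - (p * Real.cosh x) ^ 2) := fun x => by positivity
  constructor
  · have := mono (fun x hx => (hH x hx).sub ((hΛ x hx).const_mul p)) fun x hx => by
      have : p ≤ p * Real.cosh x := le_mul_of_one_le_right hpI.1.le (Real.one_le_cosh x)
      nlinarith [hnn x]
    simp [h.zero] at this
    rw [← hval]; linarith
  · have := mono (fun x hx => ((hΛ x hx).const_mul L).sub (hH x hx)) fun x hx => by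
      nlinarith [hnn x, hpc x hx]
    simp [h.zero] at this
    rw [← hval]; linarith

lemma slitLift_zero {L : ℝ} (hL : L ∈ Ioo (0 : ℝ) 1) :
    ∃ x₀ : ℝ, 0 ≤ x₀ ∧ L * Real.cosh x₀ = 1 ∧ slitLift L 0 = x₀ := by
  have hroot : slitRoot L 0 = (√(1 - L ^ 2) : ℝ) := by
    rw [slitRoot, Real.sqrt_eq_rpow, Complex.ofReal_cpow (by nlinarith [hL.1, hL.2])]
    simp
  have hx : slitLift L 0 = ((Real.log (1 + √(1 - L ^ 2)) - Real.log L : ℝ) : ℂ) := by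
    rw [slitLift, hroot, Complex.ofReal_sub, Complex.ofReal_log (x := 1 + √(1 - L ^ 2)) (by positivity)]
    push_cast
    ring
  refine ⟨_, ?_, ?_, hx⟩
  · have h1 := Real.log_neg hL.1 hL.2
    have h2 := Real.log_nonneg (le_add_of_nonneg_right (a := (1 : ℝ)) (Real.sqrt_nonneg (1 - L ^ 2)))
    linarith
  · have := mul_cosh_slitLift (u := 0) hL.1
    rw [hx, Complex.exp_zero, ← Complex.ofReal_cosh] at this
    exact_mod_cast this

lemma slitUniformizer_norm_near_slit {L : ℝ} {Λ : ℂ → ℂ} (h : IsSlitPrimitive (L ^ 2) Λ)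
    (hL : L ∈ Ioo (0 : ℝ) 1) {ε : ℝ} (hε : 0 < ε) : ∃ δ > 0, ∀ w : ℂ, L * ‖w‖ < 1 → w ∉ slit L →
      Metric.infDist w (slit L) < δ → |‖slitUniformizer L Λ w‖ - 1| < ε := by
  have hκ := angularMean_pos (sq_mem_Ioo hL)
  set κ := angularMean (L ^ 2) with hκdef
  obtain ⟨C, hC, δ, hδ, hb⟩ := h.exists_abs_re_le (sq_mem_Ioo hL)
  obtain ⟨η', hη', hexp⟩ := Metric.continuous_iff.1 Real.continuous_exp 0 ε hε
  set η := min δ (η' * κ / (2 * C)) with hη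
  have hη0 : 0 < η := lt_min hδ (by positivity)
  -- With this `δ` the bound `1 + δ/L` on `cosh(Re s)` is exactly `cosh η`, so `|Re s| ≤ η`.
  refine ⟨L * (Real.cosh η - 1), mul_pos hL.1 (sub_pos.2 (Real.one_lt_cosh.2 hη0.ne')),
    fun w _ hw2 hd => ?_⟩
  have hw0 : w ≠ 0 := fun h0 => hw2 ⟨0, ⟨by linarith [hL.1], hL.1.le⟩, by simp [h0]⟩
  have h1 := cosh_re_slitLift_le hL.1 (Complex.exp_log hw0) hd.le
  rw [mul_div_cancel_left₀ _ hL.1.ne', add_sub_cancel, Real.cosh_le_cosh, abs_of_pos hη0] at h1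
  have h2 := hb _ (h1.trans (min_le_left _ _))
  rw [slitUniformizer, Complex.norm_exp, liftedUniformizer, ← hκdef, Complex.div_ofReal_re]
  have := hexp ((Λ (slitLift L (Complex.log w))).re / κ) (by
    rw [Real.dist_eq, sub_zero, abs_div, abs_of_pos hκ, div_lt_iff₀ hκ]
    refine h2.trans_lt ?_
    have h3 : C * |(slitLift L (Complex.log w)).re| ≤ C * (η' * κ / (2 * C)) :=
      mul_le_mul_of_nonneg_left (h1.trans (min_le_right _ _)) hC.le
    have h4 : C * (η' * κ / (2 * C)) = η' * κ / 2 := by field_simp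
    have : 0 < η' * κ := by positivity
    linarith)
  rwa [Real.exp_zero, Real.dist_eq] at this

lemma exists_isSlitUniformizer {L : ℝ} (hL : L ∈ Ioo (0 : ℝ) 1) : ∃ (M : ℝ) (G : ℂ → ℂ),
    IsSlitUniformizer L (Real.exp (M / angularMean (L ^ 2))) G ∧
    L ^ 2 * M ≤ Real.arcsin (L / √(1 + L ^ 2)) ∧ Real.arcsin (L / √(1 + L ^ 2)) ≤ L * M := by
  obtain ⟨Λ, h⟩ := exists_isSlitPrimitive (sq_mem_Ioo hL)
  obtain ⟨x₀, hx₀, hcosh, hS⟩ := slitLift_zero hL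
  have hκ := angularMean_pos (sq_mem_Ioo hL)
  have h0 : (0 : ℂ) ∈ slitCover L := by simpa using mem_slitCover_mul_I hL 0
  have hG1 : slitUniformizer L Λ 1 = Complex.exp (liftedUniformizer L Λ 0) := by
    rw [← slitUniformizer_exp h hL h0, Complex.exp_zero]
  refine ⟨(Λ x₀).re, slitUniformizer L Λ, ⟨fun w hw1 hw2 => ?_, fun w => Complex.exp_ne_zero _,
    fun θ => ?_, ?_, fun θ => ?_, fun r hr => ?_, fun ε hε => ?_⟩,
    h.re_ofReal_bounds hL hx₀ hcosh⟩
  · have hw0 : w ≠ 0 := fun h0 => hw2 ⟨0, ⟨by linarith [hL.1], hL.1.le⟩, by simp [h0]⟩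
    have := hasDerivAt_slitUniformizer h hL (u := Complex.log w) (by
      show L * ‖Complex.exp (Complex.log w)‖ < 1 ∧ Complex.exp (Complex.log w) ∉ slit L
      rw [Complex.exp_log hw0]; exact ⟨hw1, hw2⟩)
    rw [Complex.exp_log hw0] at this
    exact this.differentiableAt
  · rw [slitUniformizer_exp h hL (mem_slitCover_mul_I hL θ), hG1, ← Complex.exp_add]
    congr 1
    rw [liftedUniformizer, liftedUniformizer, comp_slitLift_mul_I h hL]
    push_cast
    ring
  · rw [hG1, Complex.norm_exp, liftedUniformizer, hS, Complex.div_ofReal_re]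
  · have := hasDerivAt_slitUniformizer h hL (mem_slitCover_mul_I hL θ)
    rw [invSqrtOneSub_mul_slitRoot_circle hL] at this
    refine this.congr_deriv ?_
    push_cast
    simp only [div_div_eq_mul_div, div_one]
  · have hmem : ∀ θ : ℝ, (Real.log r + θ * Complex.I : ℂ) ∈ slitCover L := fun θ => by
      have hr0 : 0 < r := hL.1.trans hr.1
      refine mem_slitCover_of_re hL ?_ ?_
      · simpa [Real.exp_log hr0] using hr.1
      · simpa using (Real.log_neg hr0 hr.2).le
    refine ⟨fun θ => liftedUniformizer L Λ (Real.log r + θ * Complex.I), ?_, fun θ => ?_, ?_⟩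
    · rw [continuous_iff_continuousAt]
      intro θ
      have h1 := ((hasDerivAt_comp_slitLift h hL.1 (hmem θ)).div_const
        (angularMean (L ^ 2) : ℂ)).continuousAt
      exact ContinuousAt.comp (f := fun θ : ℝ => (Real.log r + θ * Complex.I : ℂ)) h1
        (by fun_prop)
    · rw [← slitUniformizer_exp h hL (hmem θ), Complex.exp_add, ← Complex.ofReal_exp,
        Real.exp_log (hL.1.trans hr.1)]
    · have := liftedUniformizer_add_two_pi h hL (hmem 0)
      simp only [Complex.ofReal_mul, Complex.ofReal_ofNat, Complex.ofReal_zero, zero_mul,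
        add_zero] at this ⊢
      exact this
  · exact slitUniformizer_norm_near_slit h hL hε

/-! ### Conformal maps of an annulus near its two ends. -/

lemma isPreconnected_ring {a b : ℝ} (ha : 0 < a) (hb : 0 < b) :
    IsPreconnected {z : ℂ | a < ‖z‖ ∧ ‖z‖ < b} := by
  have himg : {z : ℂ | a < ‖z‖ ∧ ‖z‖ < b} =
      Complex.exp '' (Complex.re ⁻¹' Ioo (Real.log a) (Real.log b)) := by
    ext z
    constructor
    · rintro ⟨h1, h2⟩
      have hz : z ≠ 0 := norm_pos_iff.1 (ha.trans h1)
      refine ⟨Complex.log z, ?_, Complex.exp_log hz⟩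
      show (Complex.log z).re ∈ Ioo (Real.log a) (Real.log b)
      rw [Complex.log_re]
      exact ⟨Real.log_lt_log ha h1, Real.log_lt_log (ha.trans h1) h2⟩
    · rintro ⟨t, ht, rfl⟩
      have ht' : Real.log a < t.re ∧ t.re < Real.log b := ht
      show a < ‖Complex.exp t‖ ∧ ‖Complex.exp t‖ < b
      rw [Complex.norm_exp]
      exact ⟨(Real.log_lt_iff_lt_exp ha).1 ht'.1, (Real.lt_log_iff_exp_lt hb).1 ht'.2⟩
  rw [himg]
  exact ((convex_Ioo _ _).linear_preimage Complex.reLm).isPreconnected.image _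
    Complex.continuous_exp.continuousOn

lemma isPreconnected_annulus {q : ℝ} (hq : 0 < q) : IsPreconnected (annulus q) :=
  isPreconnected_ring hq one_pos

lemma exists_isPreconnected_subset_outerEnd {s : Set ℂ} (hs : s ∈ outerEnd) :
    ∃ t ∈ outerEnd, t ⊆ s ∧ IsPreconnected t := by
  obtain ⟨r, hr, h⟩ := eventually_outerEnd.1 hs
  refine ⟨_, annulus_mem_outerEnd (q := max r (1 / 2)) (max_lt hr (by norm_num)), fun z hz => ?_,
    isPreconnected_annulus (lt_max_of_lt_right (by norm_num))⟩
  exact h z ((le_max_left _ _).trans_lt hz.1) hz.2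

lemma exists_isPreconnected_subset_innerEnd {q : ℝ} (hq : 0 < q) {s : Set ℂ}
    (hs : s ∈ innerEnd q) : ∃ t ∈ innerEnd q, t ⊆ s ∧ IsPreconnected t := by
  obtain ⟨r, hr, h⟩ := eventually_innerEnd.1 hs
  refine ⟨{z : ℂ | q < ‖z‖ ∧ ‖z‖ < r}, ?_, fun z hz => h z hz.1 hz.2, isPreconnected_ring hq (hq.trans hr)⟩
  exact eventually_innerEnd.2 ⟨r, hr, fun z h1 h2 => ⟨h1, h2⟩⟩

namespace IsConformalEquiv

variable {q L : ℝ} {f : ℂ → ℂ} {V : Set ℂ}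

/-- The inverse of a conformal equivalence of an annulus is continuous. -/
lemma continuousAt_invFunOn (hf : IsConformalEquiv f (annulus q) V) (hq : q ∈ Ioo (0 : ℝ) 1)
    {w : ℂ} (hw : w ∈ V) : ContinuousAt (Function.invFunOn f (annulus q)) w := by
  have hinv := hf.2.invOn_invFunOn
  have hmem : Function.invFunOn f (annulus q) w ∈ annulus q :=
    hf.2.surjOn.mapsTo_invFunOn hw
  have hopen : ∀ s ⊆ annulus q, IsOpen s → IsOpen (f '' s) := by
    -- Open mapping theorem; the constant alternative contradicts injectivity.
    rcases (hf.1.analyticOnNhd (isOpen_annulus q)).is_constant_or_isOpen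
      (isPreconnected_annulus hq.1) with ⟨c, hc⟩ | h
    · exfalso
      obtain ⟨a, ha1, ha2⟩ := exists_between hq.2
      obtain ⟨b, hb1, hb2⟩ := exists_between ha2
      have ha0 := hq.1.trans ha1
      have hA : (a : ℂ) ∈ annulus q := by
        simp [annulus, abs_of_pos ha0, ha1, ha2]
      have hB : (b : ℂ) ∈ annulus q := by
        simp [annulus, abs_of_pos (ha0.trans hb1), ha1.trans hb1, hb2]
      have := hf.2.injOn hA hB ((hc _ hA).trans (hc _ hB).symm)
      exact hb1.ne (by exact_mod_cast this)
    · exact h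
  intro N hN
  obtain ⟨U, hUN, hU, hwU⟩ := mem_nhds_iff.1 hN
  have hUo := hopen (U ∩ annulus q) inter_subset_right (hU.inter (isOpen_annulus q))
  refine mem_map.2 (mem_of_superset (hUo.mem_nhds ⟨_, ⟨hwU, hmem⟩, hinv.2 hw⟩) ?_)
  rintro _ ⟨z, ⟨hzU, hzA⟩, rfl⟩
  exact hUN (by rw [hinv.1 hzA]; exact hzU)

/-- A conformal equivalence of an annulus leaves every compact set at the ends. -/
lemma eventually_notMem (hf : IsConformalEquiv f (annulus q) V) (hq : q ∈ Ioo (0 : ℝ) 1)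
    {K : Set ℂ} (hK : IsCompact K) (hKV : K ⊆ V) :
    (∀ᶠ z in outerEnd, f z ∉ K) ∧ ∀ᶠ z in innerEnd q, f z ∉ K := by
  set g := Function.invFunOn f (annulus q) with hg
  have hK' : IsClosed (norm '' (g '' K)) :=
    ((hK.image_of_continuousOn fun w hw =>
      (hf.continuousAt_invFunOn hq (hKV hw)).continuousWithinAt).image continuous_norm).isClosed
  have hsub : ∀ r ∈ norm '' (g '' K), q < r ∧ r < 1 := by
    rintro _ ⟨_, ⟨w, hw, rfl⟩, rfl⟩
    exact hf.2.surjOn.mapsTo_invFunOn (hKV hw)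
  have key : ∀ z ∈ annulus q, ‖z‖ ∉ norm '' (g '' K) → f z ∉ K := fun z hz hn hfz =>
    hn ⟨z, ⟨f z, hfz, hf.2.invOn_invFunOn.1 hz⟩, rfl⟩
  constructor
  · have h1 : ∀ᶠ r in 𝓝[<] (1 : ℝ), r ∉ norm '' (g '' K) :=
      nhdsWithin_le_nhds (hK'.isOpen_compl.mem_nhds fun h => (hsub _ h).2.ne rfl)
    filter_upwards [annulus_mem_outerEnd hq.2, tendsto_comap.eventually h1] with z hz hn
    exact key z hz hn
  · have h1 : ∀ᶠ r in 𝓝[>] q, r ∉ norm '' (g '' K) :=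
      nhdsWithin_le_nhds (hK'.isOpen_compl.mem_nhds fun h => (hsub _ h).1.ne rfl)
    filter_upwards [annulus_mem_innerEnd hq.2, tendsto_comap.eventually h1] with z hz hn
    exact key z hz hn

/-- For `L < r < 1` the circle `|w| = r` is compact in the slit disk, so near the end its image is
avoided and, by connectedness, `f` stays on one side. If it stays inside for some `r`, properness
pushes it to the slit; if it is outside for every `r`, then `|f| → 1`. -/
lemma end_dichotomy (hf : IsConformalEquiv f (annulus q) (slitDisk L)) (hL1 : L < 1)
    {l : Filter ℂ} (hA : annulus q ∈ l)
    (hpre : ∀ s ∈ l, ∃ t ∈ l, t ⊆ s ∧ IsPreconnected t)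
    (hprop : ∀ K, IsCompact K → K ⊆ slitDisk L → ∀ᶠ z in l, f z ∉ K) :
    Tendsto (fun z => ‖f z‖) l (𝓝 1) ∨
      ((∃ r < 1, ∀ᶠ z in l, ‖f z‖ < r) ∧
        Tendsto (fun z => Metric.infDist (f z) (slit L)) l (𝓝 0)) := by
  have hV : ∀ z ∈ annulus q, ‖f z‖ < 1 ∧ f z ∉ slit L := fun z hz => by
    have := hf.2.mapsTo hz
    exact ⟨by simpa using this.1, this.2⟩
  have hcase : ∀ r ∈ Ioo L 1, (∀ᶠ z in l, ‖f z‖ < r) ∨ ∀ᶠ z in l, r < ‖f z‖ := by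
    intro r hr
    have hne := hprop (Metric.sphere 0 r) (isCompact_sphere _ _) fun w hw => by
      have hw' : ‖w‖ = r := by simpa using hw
      exact ⟨by simpa [hw'] using hr.2, fun h => absurd (norm_le_of_mem_slit h)
        (by rw [hw']; exact not_le.2 hr.1)⟩
    obtain ⟨t, htl, hts, htc⟩ := hpre _ (inter_mem hne hA)
    by_cases hall : ∀ z ∈ t, ‖f z‖ < r
    · exact Or.inl (mem_of_superset htl hall)
    · right
      push Not at hall
      obtain ⟨z₁, hz₁, h1⟩ := hall
      filter_upwards [htl] with z hz
      by_contra hcon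
      obtain ⟨z', hz', h'⟩ := htc.intermediate_value hz hz₁ (f := fun z => ‖f z‖)
        ((hf.1.mono fun z hz => (hts hz).2).continuousOn.norm) ⟨not_lt.1 hcon, h1⟩
      exact (hts hz').1 (by simpa using h')
  by_cases h : ∃ r ∈ Ioo L 1, ∀ᶠ z in l, ‖f z‖ < r
  · right
    obtain ⟨r, hr, hev⟩ := h
    refine ⟨⟨r, hr.2, hev⟩, ?_⟩
    rw [tendsto_order]
    refine ⟨fun a ha => Eventually.of_forall fun z => ha.trans_le Metric.infDist_nonneg,
      fun ε hε => ?_⟩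
    have hKc : IsCompact {w : ℂ | ‖w‖ ≤ r ∧ ε ≤ Metric.infDist w (slit L)} := by
      refine (isCompact_closedBall (0 : ℂ) r).of_isClosed_subset ?_ fun z hz => by simpa using hz.1
      exact (isClosed_le continuous_norm continuous_const).inter
        (isClosed_le continuous_const (Metric.continuous_infDist_pt _))
    have hK := hprop _ hKc fun w hw => ⟨by simpa using hw.1.trans_lt hr.2, fun h => by
      have := hw.2
      have h : w ∈ slit L := h
      rw [Metric.infDist_zero_of_mem h] at this
      linarith⟩
    filter_upwards [hK, hev] with z hz hzr
    by_contra hcon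
    exact hz ⟨hzr.le, not_lt.1 hcon⟩
  · left
    rw [tendsto_order]
    refine ⟨fun a ha => ?_, fun a ha => ?_⟩
    · obtain ⟨r, hr1, hr2⟩ := exists_between (max_lt ha hL1)
      rw [max_lt_iff] at hr1
      filter_upwards [(hcase r ⟨hr1.2, hr2⟩).resolve_left fun hh =>
        h ⟨r, ⟨hr1.2, hr2⟩, hh⟩] with z hz
      exact hr1.1.trans hz
    · filter_upwards [hA] with z hz
      exact (hV z hz).1.trans ha

lemma outer_dichotomy (hf : IsConformalEquiv f (annulus q) (slitDisk L))
    (hq : q ∈ Ioo (0 : ℝ) 1) (hL1 : L < 1) :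
    Tendsto (fun z => ‖f z‖) outerEnd (𝓝 1) ∨
      ((∃ r < 1, ∀ᶠ z in outerEnd, ‖f z‖ < r) ∧
        Tendsto (fun z => Metric.infDist (f z) (slit L)) outerEnd (𝓝 0)) :=
  hf.end_dichotomy hL1 (annulus_mem_outerEnd hq.2)
    (fun _ => exists_isPreconnected_subset_outerEnd) fun _ hK hKV => (hf.eventually_notMem hq hK hKV).1

lemma inner_dichotomy (hf : IsConformalEquiv f (annulus q) (slitDisk L))
    (hq : q ∈ Ioo (0 : ℝ) 1) (hL1 : L < 1) :
    Tendsto (fun z => ‖f z‖) (innerEnd q) (𝓝 1) ∨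
      ((∃ r < 1, ∀ᶠ z in innerEnd q, ‖f z‖ < r) ∧
        Tendsto (fun z => Metric.infDist (f z) (slit L)) (innerEnd q) (𝓝 0)) :=
  hf.end_dichotomy hL1 (annulus_mem_innerEnd hq.2)
    (fun _ => exists_isPreconnected_subset_innerEnd hq.1)
    fun _ hK hKV => (hf.eventually_notMem hq hK hKV).2

end IsConformalEquiv

lemma norm_ofReal_annulus {q : ℝ} (hq : q ∈ Ioo (0 : ℝ) 1) :
    (((q + 1) / 2 : ℝ) : ℂ) ∈ annulus q := by
  have : 0 < (q + 1) / 2 := by linarith [hq.1]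
  simp only [annulus, mem_ofPred_eq, Complex.norm_real, Real.norm_of_nonneg this.le]
  constructor <;> linarith [hq.2]

/-! ### Exclusion of the degenerate slit. -/

/-- An annulus is not conformally equivalent to the punctured disk. -/
lemma not_conformallyEquivalent_slitDisk_zero {q : ℝ} (hq : q ∈ Ioo (0 : ℝ) 1) :
    ¬ ConformallyEquivalent (annulus q) (slitDisk 0) := by
  rintro ⟨f, hf⟩
  have hslit : slit 0 = {0} := by simp [slit]
  have hinf : ∀ w, Metric.infDist w (slit 0) = ‖w‖ := fun w => by
    rw [hslit, Metric.infDist_singleton, dist_zero_right]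
  have hlt : ∀ z ∈ annulus q, ‖f z‖ < 1 := fun z hz => by simpa using (hf.2.mapsTo hz).1
  have hne : ∀ z ∈ annulus q, f z ≠ 0 := fun z hz h => (hf.2.mapsTo hz).2 <| by
    show f z ∈ slit 0
    rw [hslit, h]; rfl
  have hn1 : Tendsto (fun z : ℂ => ‖z‖) outerEnd (𝓝 1) :=
    tendsto_comap.mono_right nhdsWithin_le_nhds
  have hnq : Tendsto (fun z : ℂ => ‖z‖) (innerEnd q) (𝓝 q) :=
    tendsto_comap.mono_right nhdsWithin_le_nhds
  have hr1 : ∀ β : ℝ, Tendsto (fun z : ℂ => ‖z‖ ^ β) outerEnd (𝓝 1) := fun β => by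
    simpa using hn1.rpow_const (p := β) (Or.inl one_ne_zero)
  have hrq : ∀ β : ℝ, Tendsto (fun z : ℂ => ‖z‖ ^ β) (innerEnd q) (𝓝 (q ^ β)) := fun β =>
    hnq.rpow_const (p := β) (Or.inl hq.1.ne')
  set z₀ : ℂ := (((q + 1) / 2 : ℝ) : ℂ)
  have hz₀ : z₀ ∈ annulus q := norm_ofReal_annulus hq
  have hz₀0 : 0 < ‖z₀‖ := hq.1.trans hz₀.1
  have hpow : ∀ s : ℝ, 0 ≤ s → s < 1 → ¬ ∀ m : ℕ, ‖f z₀‖ ≤ s ^ m := fun s hs0 hs1 h => by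
    have := ge_of_tendsto' (tendsto_pow_atTop_nhds_zero_of_lt_one hs0 hs1) h
    exact hne _ hz₀ (norm_le_zero_iff.1 this)
  -- If `|f| → 1` at both ends, `f` is a monomial of exponent `0`, contradicting injectivity. If `f
  -- → 0` at one end, that end contributes nothing to the maximum principle with weight `|z|^{±m}`,
  -- for every `m`, and the other end forces `f(z₀) = 0`.
  rcases hf.inner_dichotomy hq zero_lt_one with hi | ⟨-, hi⟩
  · rcases hf.outer_dichotomy hq zero_lt_one with ho | ⟨-, ho⟩
    · obtain ⟨c, n, -, -, hqn, hform⟩ :=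
        exists_eq_const_mul_zpow hq hf.1 hne one_pos one_pos ho hi
      rw [one_mul] at hqn
      have hn : n = 0 := by
        exact (zpow_eq_one_iff_right₀ hq.1.le hq.2.ne).1 hqn
      have hneg : -z₀ ∈ annulus q := by simpa [annulus] using hz₀
      have := hf.2.injOn hz₀ hneg (by rw [hform _ hz₀, hform _ hneg, hn]; simp)
      exact norm_pos_iff.1 hz₀0 (self_eq_neg.1 this)
    · simp only [hinf] at ho
      refine hpow (q / ‖z₀‖) (div_nonneg hq.1.le hz₀0.le) ((div_lt_one hz₀0).2 hz₀.1) fun m => ?_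
      have := norm_mul_rpow_le_of_ends hq hf.1 (α := m) (C := q ^ (m : ℝ)) (fun ε hε => ?_)
        (fun ε hε => ?_) z₀ hz₀
      · rw [Real.rpow_natCast, Real.rpow_natCast] at this
        rwa [div_pow, le_div_iff₀ (pow_pos hz₀0 m)]
      · have h1 := ho.mul (hr1 m)
        rw [zero_mul] at h1
        exact (h1.eventually_le_const (by
          have := Real.rpow_pos_of_pos hq.1 (m : ℝ)
          linarith))
      · filter_upwards [(hrq m).eventually_le_const (lt_add_of_pos_right _ hε),
          annulus_mem_innerEnd hq.2] with z h1 hz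
        refine le_trans (mul_le_of_le_one_left (Real.rpow_nonneg (norm_nonneg _) _) ?_) h1
        exact (hlt z hz).le
  · simp only [hinf] at hi
    refine hpow ‖z₀‖ (norm_nonneg _) hz₀.2 fun m => ?_
    have := norm_mul_rpow_le_of_ends hq hf.1 (α := -m) (C := 1) (fun ε hε => ?_)
      (fun ε hε => ?_) z₀ hz₀
    · rw [Real.rpow_neg hz₀0.le, Real.rpow_natCast, ← div_eq_mul_inv,
        div_le_one (pow_pos hz₀0 m)] at this
      exact this
    · filter_upwards [(hr1 (-m)).eventually_le_const (lt_add_of_pos_right _ hε),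
        annulus_mem_outerEnd hq.2] with z h1 hz
      refine le_trans (mul_le_of_le_one_left (Real.rpow_nonneg (norm_nonneg _) _) ?_) h1
      exact (hlt z hz).le
    · have h1 := hi.mul (hrq (-m))
      rw [zero_mul] at h1
      exact h1.eventually_le_const (by linarith)

/-! ### Rigidity. -/

namespace IsSlitUniformizer

variable {L ρ : ℝ} {G : ℂ → ℂ}

lemma norm_circle (hG : IsSlitUniformizer L ρ G) {w : ℂ} (hw : ‖w‖ = 1) : ‖G w‖ = ρ := by
  have h := hG.circle w.arg
  have hexp : Complex.exp (w.arg * Complex.I) = w := by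
    simpa [hw] using Complex.norm_mul_exp_arg_mul_I w
  rw [hexp] at h
  rw [h, norm_mul, Complex.norm_exp_ofReal_mul_I, mul_one, hG.norm_one]

lemma mem_domain (hL : L ∈ Ioo (0 : ℝ) 1) {w : ℂ} (h1 : L < ‖w‖) (h2 : ‖w‖ ≤ 1) :
    L * ‖w‖ < 1 ∧ w ∉ slit L :=
  ⟨mul_norm_lt_one_of_norm_le_one hL h2, fun h => absurd (norm_le_of_mem_slit h) (not_le.2 h1)⟩

/-- Only `|f| → 1` is known, not convergence of `f`. Uniform continuity of `|G|` on a closed ring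
compares `f(z)` with its radial projection to the circle, where `|G| = ρ`. -/
lemma tendsto_norm_of_norm_tendsto_one (hG : IsSlitUniformizer L ρ G) (hL : L ∈ Ioo (0 : ℝ) 1)
    {f : ℂ → ℂ} {l : Filter ℂ} (hf : Tendsto (fun z => ‖f z‖) l (𝓝 1))
    (hf1 : ∀ᶠ z in l, ‖f z‖ < 1) : Tendsto (fun z => ‖G (f z)‖) l (𝓝 ρ) := by
  set K : Set ℂ := {w : ℂ | (L + 1) / 2 ≤ ‖w‖ ∧ ‖w‖ ≤ 1} with hK
  have hKc : IsCompact K := by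
    refine (isCompact_closedBall (0 : ℂ) 1).of_isClosed_subset ?_ fun z hz => by simpa using hz.2
    exact (isClosed_le continuous_const continuous_norm).inter
      (isClosed_le continuous_norm continuous_const)
  have hc : ContinuousOn (fun w => ‖G w‖) K := fun w hw => by
    have := mem_domain hL (by linarith [hw.1, hL.2]) hw.2
    exact (hG.differentiableAt w this.1 this.2).continuousAt.norm.continuousWithinAt
  have huc := Metric.uniformContinuousOn_iff.1 (hKc.uniformContinuousOn_of_continuous hc)
  rw [Metric.tendsto_nhds]
  intro ε hε
  obtain ⟨δ, hδ, H⟩ := huc ε hε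
  have hL2 : (L + 1) / 2 < 1 := by linarith [hL.2]
  filter_upwards [hf.eventually (lt_mem_nhds hL2), hf1,
    hf.eventually (lt_mem_nhds (show 1 - δ < 1 by linarith))] with z h1 h2 h3
  have hpos : 0 < ‖f z‖ := by linarith [hL.1]
  have hn : ‖f z / ‖f z‖‖ = 1 := by
    rw [norm_div, Complex.norm_real, norm_norm, div_self hpos.ne']
  have := H (f z) ⟨h1.le, h2.le⟩ (f z / ‖f z‖) ⟨by rw [hn]; exact hL2.le, hn.le⟩ (by
    have he : f z - f z / ‖f z‖ = f z / ‖f z‖ * ((‖f z‖ - 1 : ℝ) : ℂ) := by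
      have : (‖f z‖ : ℂ) ≠ 0 := by exact_mod_cast hpos.ne'
      push_cast
      field_simp
    rw [dist_eq_norm, he, norm_mul, hn, one_mul, Complex.norm_real, Real.norm_eq_abs, abs_lt]
    constructor <;> linarith)
  simpa only [hG.norm_circle hn] using this

lemma tendsto_norm_of_infDist (hG : IsSlitUniformizer L ρ G) (hL : L ∈ Ioo (0 : ℝ) 1)
    {f : ℂ → ℂ} {l : Filter ℂ}
    (hf : Tendsto (fun z => Metric.infDist (f z) (slit L)) l (𝓝 0))
    (hf1 : ∀ᶠ z in l, ‖f z‖ < 1 ∧ f z ∉ slit L) : Tendsto (fun z => ‖G (f z)‖) l (𝓝 1) := by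
  rw [Metric.tendsto_nhds]
  intro ε hε
  obtain ⟨δ, hδ, H⟩ := hG.norm_near_slit ε hε
  filter_upwards [hf.eventually (gt_mem_nhds hδ), hf1] with z h1 h2
  exact H _ (mul_norm_lt_one_of_norm_le_one hL h2.1.le) h2.2 h1

/-- The rigidity of conformal equivalences of an annulus with a slit disk. -/
lemma rigidity (hG : IsSlitUniformizer L ρ G) (hL : L ∈ Ioo (0 : ℝ) 1) (hρ : 1 < ρ) {q : ℝ}
    (hq : q ∈ Ioo (0 : ℝ) 1) {f : ℂ → ℂ} (hf : IsConformalEquiv f (annulus q) (slitDisk L)) :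
    ρ * q = 1 ∧ (Tendsto (fun z => ‖f z‖) outerEnd (𝓝 1) →
      ∃ c : ℂ, c ≠ 0 ∧ ∀ z ∈ annulus q, G (f z) = c * z) := by
  have hρ0 : 0 < ρ := one_pos.trans hρ
  have hV : ∀ z ∈ annulus q, ‖f z‖ < 1 ∧ f z ∉ slit L := fun z hz => by
    have := hf.2.mapsTo hz
    exact ⟨by simpa using this.1, this.2⟩
  have hd : DifferentiableOn ℂ (fun z => G (f z)) (annulus q) := fun z hz => by
    have := hV z hz
    exact DifferentiableAt.comp_differentiableWithinAt z (hG.differentiableAt _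
      (mul_norm_lt_one_of_norm_le_one hL this.1.le) this.2) (hf.1 z hz)
  have hVo : ∀ᶠ z in outerEnd, ‖f z‖ < 1 ∧ f z ∉ slit L := by
    filter_upwards [annulus_mem_outerEnd hq.2] with z hz using hV z hz
  have hVi : ∀ᶠ z in innerEnd q, ‖f z‖ < 1 ∧ f z ∉ slit L := by
    filter_upwards [annulus_mem_innerEnd hq.2] with z hz using hV z hz
  have ho := hf.outer_dichotomy hq hL.2
  have hi := hf.inner_dichotomy hq hL.2
  obtain ⟨A, hA, hAo, hAρ⟩ : ∃ A, (A = ρ ∨ A = 1) ∧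
      Tendsto (fun z => ‖G (f z)‖) outerEnd (𝓝 A) ∧
      (Tendsto (fun z => ‖f z‖) outerEnd (𝓝 1) → A = ρ) := by
    by_cases h : Tendsto (fun z => ‖f z‖) outerEnd (𝓝 1)
    · exact ⟨ρ, Or.inl rfl, hG.tendsto_norm_of_norm_tendsto_one hL h (hVo.mono fun _ h => h.1),
        fun _ => rfl⟩
    · exact ⟨1, Or.inr rfl, hG.tendsto_norm_of_infDist hL (ho.resolve_left h).2 hVo,
        fun h' => absurd h' h⟩
  obtain ⟨B, hB, hBi⟩ : ∃ B, (B = ρ ∨ B = 1) ∧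
      Tendsto (fun z => ‖G (f z)‖) (innerEnd q) (𝓝 B) := by
    rcases hi with h | ⟨-, h⟩
    · exact ⟨ρ, Or.inl rfl, hG.tendsto_norm_of_norm_tendsto_one hL h (hVi.mono fun _ h => h.1)⟩
    · exact ⟨1, Or.inr rfl, hG.tendsto_norm_of_infDist hL h hVi⟩
  have hA0 : 0 < A := by rcases hA with rfl | rfl <;> linarith
  have hB0 : 0 < B := by rcases hB with rfl | rfl <;> linarith
  obtain ⟨c, n, hc0, -, hqn, hform⟩ :=
    exists_eq_const_mul_zpow hq hd (fun z _ => hG.ne_zero _) hA0 hB0 hAo hBi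
  -- The circle of radius `(L + 1)/2` winds once under `G`; its preimage under `f` is a loop in the
  -- annulus whose `n`-th power carries this winding.
  have hn : IsUnit n := by
    have hr : (L + 1) / 2 ∈ Ioo L 1 := ⟨by linarith [hL.2], by linarith [hL.2]⟩
    have hr0 : 0 < (L + 1) / 2 := hL.1.trans hr.1
    obtain ⟨γ, hγc, hγ, hγ2⟩ := hG.winding _ hr
    have hw : ∀ θ : ℝ, (((L + 1) / 2 : ℝ) : ℂ) * Complex.exp (θ * Complex.I) ∈ slitDisk L :=
      fun θ => by
        have hnorm : ‖(((L + 1) / 2 : ℝ) : ℂ) * Complex.exp (θ * Complex.I)‖ = (L + 1) / 2 := by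
          rw [norm_mul, Complex.norm_exp_ofReal_mul_I, mul_one, Complex.norm_real,
            Real.norm_of_nonneg hr0.le]
        exact ⟨by rw [mem_ball_zero_iff, hnorm]; exact hr.2,
          (mem_domain hL (by rw [hnorm]; exact hr.1) (by rw [hnorm]; exact hr.2.le)).2⟩
    set y : ℝ → ℂ := fun θ => Function.invFunOn f (annulus q)
      ((((L + 1) / 2 : ℝ) : ℂ) * Complex.exp (θ * Complex.I)) with hy
    have hyA : ∀ θ, y θ ∈ annulus q := fun θ => hf.2.surjOn.mapsTo_invFunOn (hw θ)
    refine isUnit_of_exp_eq_const_mul_zpow (γ := γ) (y := y) (a := 0) (b := 2 * Real.pi) hγc ?_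
      (fun t => norm_pos_iff.1 (hq.1.trans (hyA t).1)) ?_ hγ2 (c := c) (n := n) fun t => ?_
    · rw [continuous_iff_continuousAt]
      intro θ
      exact ContinuousAt.comp (f := fun θ : ℝ =>
        (((L + 1) / 2 : ℝ) : ℂ) * Complex.exp (θ * Complex.I))
        (hf.continuousAt_invFunOn hq (hw θ)) (by fun_prop)
    · simp [hy]
    · rw [← hγ, ← hform _ (hyA t), hy]
      simp only
      rw [hf.2.invOn_invFunOn.2 (hw t)]
  -- In `A q^n = B` with `A, B ∈ {1, ρ}`, the exponent `1` forces `A = ρ`, `B = 1`, and `-1` forces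
  -- the reverse. Both give `ρ q = 1`, and `|f| → 1` at the outer end excludes `-1`.
  rcases Int.isUnit_iff.1 hn with rfl | rfl
  · rw [zpow_one] at hqn
    have hρq : ρ * q = 1 := by
      rcases hA with rfl | rfl <;> rcases hB with rfl | rfl
      · nlinarith [hq.2]
      · exact hqn
      · linarith [hq.2]
      · linarith [hq.2]
    exact ⟨hρq, fun _ => ⟨c, hc0, fun z hz => by rw [hform z hz, zpow_one]⟩⟩
  · rw [zpow_neg_one, ← div_eq_mul_inv, div_eq_iff hq.1.ne'] at hqn
    have hA1 : A ≠ ρ := fun h => by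
      rcases hB with rfl | rfl
      · nlinarith [hq.2]
      · linarith [hq.2]
    refine ⟨?_, fun h => absurd (hAρ h) hA1⟩
    rcases hB with rfl | rfl
    · rw [← hqn]; exact hA.resolve_left hA1
    · have := hA.resolve_left hA1
      linarith [hq.2]

end IsSlitUniformizer

/-! ### Symmetries of the angular integral and the circle correspondence. -/

section AngularInt

variable {p : ℝ}

lemma norm_one_sub_mul_exp_neg (p φ : ℝ) :
    ‖1 - (p : ℂ) * Complex.exp (2 * ((-φ : ℝ) * Complex.I))‖ =
      ‖1 - (p : ℂ) * Complex.exp (2 * (φ * Complex.I))‖ := by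
  rw [← Complex.norm_conj]
  congr 1
  simp only [map_sub, map_one, map_mul, Complex.conj_ofReal, ← Complex.exp_conj, Complex.conj_I,
    map_ofNat]
  congr 3
  push_cast
  ring

lemma norm_one_sub_mul_exp_pi_sub (p φ : ℝ) :
    ‖1 - (p : ℂ) * Complex.exp (2 * ((Real.pi - φ : ℝ) * Complex.I))‖ =
      ‖1 - (p : ℂ) * Complex.exp (2 * (φ * Complex.I))‖ := by
  rw [← norm_one_sub_mul_exp_neg p φ, ← Complex.exp_periodic (2 * ((-φ : ℝ) * Complex.I))]
  congr 4
  push_cast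
  ring

lemma angularInt_neg (hp : p ∈ Ioo (0 : ℝ) 1) (θ : ℝ) : angularInt p (-θ) = -angularInt p θ := by
  have hder : ∀ θ, HasDerivAt (fun θ => angularInt p (-θ) + angularInt p θ) 0 θ := fun θ => by
    have h1 := (hasDerivAt_angularInt hp (-θ)).comp θ (hasDerivAt_neg θ)
    refine (h1.add (hasDerivAt_angularInt hp θ)).congr_deriv ?_
    rw [norm_one_sub_mul_exp_neg]
    ring
  have := is_const_of_deriv_eq_zero (fun y => (hder y).differentiableAt)
    (fun y => (hder y).deriv) θ 0
  simp only [neg_zero, angularInt_zero, add_zero] at this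
  linarith

lemma angularInt_pi_sub (hp : p ∈ Ioo (0 : ℝ) 1) (θ : ℝ) :
    angularInt p (Real.pi - θ) = angularInt p Real.pi - angularInt p θ := by
  have hder : ∀ θ, HasDerivAt (fun θ => angularInt p (Real.pi - θ) + angularInt p θ) 0 θ :=
    fun θ => by
      have h1 := (hasDerivAt_angularInt hp (Real.pi - θ)).comp θ
        ((hasDerivAt_id θ).const_sub Real.pi)
      refine (h1.add (hasDerivAt_angularInt hp θ)).congr_deriv ?_
      rw [norm_one_sub_mul_exp_pi_sub]
      ring
  have := is_const_of_deriv_eq_zero (fun y => (hder y).differentiableAt)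
    (fun y => (hder y).deriv) θ 0
  simp only [sub_zero, angularInt_zero, add_zero] at this
  linarith

lemma angularInt_pi (p : ℝ) : angularInt p Real.pi = angularMean p * Real.pi := by
  rw [angularMean, div_mul_cancel₀ _ Real.pi_ne_zero]

lemma angularInt_pi_div_two (hp : p ∈ Ioo (0 : ℝ) 1) :
    angularInt p (Real.pi / 2) = angularMean p * (Real.pi / 2) := by
  have h := angularInt_pi_sub hp (Real.pi / 2)
  rw [sub_half, angularInt_pi] at h
  linarith

/-- Used on `[-π, π]` to reach every boundary point and on `[0, π/2]` to keep the angle in the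
quarter circle where the sine estimates hold. -/
lemma exists_angularInt_eq (hp : p ∈ Ioo (0 : ℝ) 1) {a b τ : ℝ} (hab : a ≤ b)
    (ha : angularInt p a = angularMean p * a) (hb : angularInt p b = angularMean p * b)
    (hτ : τ ∈ Ioc a b) : ∃ θ ∈ Ioc a b, angularInt p θ = angularMean p * τ := by
  have hκ := angularMean_pos hp
  obtain ⟨θ, hθ, h⟩ := intermediate_value_Icc hab
    (fun x _ => (hasDerivAt_angularInt hp x).continuousAt.continuousWithinAt)
    (show angularMean p * τ ∈ Icc (angularInt p a) (angularInt p b) from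
      ⟨by rw [ha]; exact mul_le_mul_of_nonneg_left hτ.1.le hκ.le,
        by rw [hb]; exact mul_le_mul_of_nonneg_left hτ.2 hκ.le⟩)
  refine ⟨θ, ⟨lt_of_le_of_ne hθ.1 ?_, hθ.2⟩, h⟩
  rintro rfl
  rw [ha] at h
  exact hτ.1.ne (mul_left_cancel₀ hκ.ne' h)

end AngularInt

lemma mem_closure_annulus {q : ℝ} (hq : q ∈ Ioo (0 : ℝ) 1) {z : ℂ} (hz : z ∈ annulusOuter q) :
    z ∈ closure (annulus q) := by
  have hz0 : 0 < ‖z‖ := hq.1.trans hz.1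
  have hc : Tendsto (fun t : ℝ => (t : ℂ) * z) (𝓝[<] 1) (𝓝 z) := by
    have : Continuous fun t : ℝ => (t : ℂ) * z := by fun_prop
    simpa using (this.tendsto 1).mono_left (nhdsWithin_le_nhds (s := Iio 1))
  refine mem_closure_of_tendsto hc ?_
  filter_upwards [Ioo_mem_nhdsLT ((div_lt_one hz0).2 hz.1)] with t ht
  have ht0 : 0 < t := (div_pos hq.1 hz0).trans ht.1
  have hn : ‖(t : ℂ) * z‖ = t * ‖z‖ := by
    rw [norm_mul, Complex.norm_real, Real.norm_of_nonneg ht0.le]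
  show q < ‖(t : ℂ) * z‖ ∧ ‖(t : ℂ) * z‖ < 1
  rw [hn]
  exact ⟨(div_lt_iff₀ hz0).1 ht.1, by nlinarith [ht.2, hz.2]⟩

lemma mem_annulusOuter_of_norm {q : ℝ} (hq : q < 1) {z : ℂ} (hz : ‖z‖ = 1) :
    z ∈ annulusOuter q := ⟨by rw [hz]; exact hq, hz.le⟩

lemma nhdsWithin_annulus_le_outerEnd (q : ℝ) {z : ℂ} (hz : ‖z‖ = 1) :
    𝓝[annulus q] z ≤ outerEnd := by
  rw [outerEnd, ← tendsto_iff_comap]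
  refine tendsto_nhdsWithin_iff.2 ⟨?_, eventually_nhdsWithin_of_forall fun z hz => hz.2⟩
  have := (continuous_norm (E := ℂ)).tendsto z
  rw [hz] at this
  exact this.mono_left nhdsWithin_le_nhds

lemma uniqueDiffWithinAt_annulusOuter {q : ℝ} (hq : q < 1) {z : ℂ} (hz : ‖z‖ = 1) :
    UniqueDiffWithinAt ℂ (annulusOuter q) z := by
  have h1 : UniqueDiffWithinAt ℂ (Metric.closedBall (0 : ℂ) 1) z := by
    refine uniqueDiffWithinAt_convex_of_isRCLikeNormedField (convex_closedBall _ _) ?_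
      (subset_closure (by simp [hz]))
    rw [interior_closedBall _ one_ne_zero]
    exact ⟨0, Metric.mem_ball_self one_pos⟩
  have h2 : {z : ℂ | q < ‖z‖} ∈ 𝓝 z :=
    (isOpen_lt continuous_const continuous_norm).mem_nhds (by
      show q < ‖z‖
      rw [hz]; exact hq)
  refine (h1.inter h2).mono fun w hw => ⟨hw.2, by simpa using hw.1⟩

lemma exp_arg_mul_I {z : ℂ} (hz : ‖z‖ = 1) : Complex.exp (z.arg * Complex.I) = z := by
  simpa [hz] using Complex.norm_mul_exp_arg_mul_I z

namespace IsSlitUniformizer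

variable {L ρ : ℝ} {G : ℂ → ℂ}

lemma exists_circle_eq (hG : IsSlitUniformizer L ρ G) (hL : L ∈ Ioo (0 : ℝ) 1) {a b τ : ℝ}
    (hab : a ≤ b) (ha : angularInt (L ^ 2) a = angularMean (L ^ 2) * a)
    (hb : angularInt (L ^ 2) b = angularMean (L ^ 2) * b) (hτ : τ ∈ Ioc a b) :
    ∃ θ ∈ Ioc a b, angularInt (L ^ 2) θ = angularMean (L ^ 2) * τ ∧
      G (Complex.exp (θ * Complex.I)) = G 1 * Complex.exp (τ * Complex.I) := by
  obtain ⟨θ, hθ, h⟩ := exists_angularInt_eq (sq_mem_Ioo hL) hab ha hb hτ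
  refine ⟨θ, hθ, h, ?_⟩
  rw [hG.circle, h, mul_div_cancel_left₀ _ (angularMean_pos (sq_mem_Ioo hL)).ne']

lemma exists_circle_eq_mul (hG : IsSlitUniformizer L ρ G) (hL : L ∈ Ioo (0 : ℝ) 1) {z : ℂ}
    (hz : ‖z‖ = 1) : ∃ w, ‖w‖ = 1 ∧ G w = G 1 * z := by
  obtain ⟨θ, -, -, h⟩ := hG.exists_circle_eq hL (a := -Real.pi) (b := Real.pi) (τ := z.arg)
    (by linarith [Real.pi_pos]) (by rw [angularInt_neg (sq_mem_Ioo hL), angularInt_pi, mul_neg])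
    (angularInt_pi _) (Complex.arg_mem_Ioc z)
  exact ⟨_, Complex.norm_exp_ofReal_mul_I θ, by rw [h, exp_arg_mul_I hz]⟩

lemma injOn_circle (hG : IsSlitUniformizer L ρ G) (hL : L ∈ Ioo (0 : ℝ) 1) {w w' : ℂ}
    (hw : ‖w‖ = 1) (hw' : ‖w'‖ = 1) (h : G w = G w') : w = w' := by
  have hp := sq_mem_Ioo hL
  have hκ := angularMean_pos hp
  have hmono := strictMono_angularInt hp
  have hbd : ∀ v : ℂ, angularInt (L ^ 2) v.arg / angularMean (L ^ 2) ∈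
      Ioc (-Real.pi) Real.pi := fun v => by
    have h1 := hmono (Complex.neg_pi_lt_arg v)
    have h2 := hmono.monotone (Complex.arg_le_pi v)
    rw [angularInt_neg hp, angularInt_pi] at h1
    rw [angularInt_pi] at h2
    exact ⟨by rw [lt_div_iff₀ hκ]; linarith, by rw [div_le_iff₀ hκ]; linarith⟩
  rw [← exp_arg_mul_I hw, ← exp_arg_mul_I hw', hG.circle, hG.circle] at h
  have h2 := congrArg Complex.arg (mul_left_cancel₀ (hG.ne_zero 1) h)
  have hπ : -Real.pi + 2 * Real.pi = Real.pi := by ring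
  rw [Complex.arg_exp_mul_I, Complex.arg_exp_mul_I, (toIocMod_eq_self _).2 (by
    rw [hπ]; exact hbd w), (toIocMod_eq_self _).2 (by rw [hπ]; exact hbd w')] at h2
  have h3 := hmono.injective ((div_left_inj' hκ.ne').1 h2)
  rw [← exp_arg_mul_I hw, ← exp_arg_mul_I hw', h3]

end IsSlitUniformizer

/-! ### Boundary values and boundary derivatives. -/

section Boundary

variable {q L ρ : ℝ} {G f : ℂ → ℂ}

lemma IsNormalizedSlitMap.tendsto_norm_outerEnd (hf : IsNormalizedSlitMap q L f)
    (hq : q ∈ Ioo (0 : ℝ) 1) (hL : L < 1) : Tendsto (fun z => ‖f z‖) outerEnd (𝓝 1) := by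
  refine (hf.1.outer_dichotomy hq hL).resolve_right ?_
  rintro ⟨⟨r, hr, hev⟩, -⟩
  have h1 := hf.2.norm
  have : (𝓝[annulus q] (1 : ℂ)).NeBot := mem_closure_iff_nhdsWithin_neBot.1
    (mem_closure_annulus hq (mem_annulusOuter_of_norm hq.2 norm_one))
  have h2 : ∀ᶠ z in 𝓝[annulus q] (1 : ℂ), ‖f z‖ < r :=
    hev.filter_mono (nhdsWithin_annulus_le_outerEnd q norm_one)
  have h3 := le_of_tendsto h1 (h2.mono fun z hz => hz.le)
  rw [norm_one] at h3
  linarith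

/-- Letting `z → 1` in `G(f(z)) = c z` identifies `c`. -/
lemma IsNormalizedSlitMap.uniformizer_comp (hf : IsNormalizedSlitMap q L f)
    (hq : q ∈ Ioo (0 : ℝ) 1) (hL : L ∈ Ioo (0 : ℝ) 1) (hρ : 1 < ρ)
    (hG : IsSlitUniformizer L ρ G) : ∀ z ∈ annulus q, G (f z) = G 1 * z := by
  obtain ⟨c, -, hc⟩ := (hG.rigidity hL hρ hq hf.1).2 (hf.tendsto_norm_outerEnd hq hL.2)
  have : (𝓝[annulus q] (1 : ℂ)).NeBot := mem_closure_iff_nhdsWithin_neBot.1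
    (mem_closure_annulus hq (mem_annulusOuter_of_norm hq.2 norm_one))
  have hm := IsSlitUniformizer.mem_domain hL (w := 1) (by simpa using hL.2) (by simp)
  have h1 := (hG.differentiableAt 1 hm.1 hm.2).continuousAt.tendsto.comp hf.2
  have h2 : Tendsto (fun z => c * z) (𝓝[annulus q] (1 : ℂ)) (𝓝 (c * 1)) :=
    ((continuous_const.mul continuous_id).tendsto 1).mono_left nhdsWithin_le_nhds
  have h3 : Tendsto (fun z => c * z) (𝓝[annulus q] (1 : ℂ)) (𝓝 (G 1)) :=
    h1.congr' (eventually_nhdsWithin_of_forall fun z hz => hc z hz)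
  have := tendsto_nhds_unique h2 h3
  rw [mul_one] at this
  exact fun z hz => this ▸ hc z hz

/-- Every cluster value `y` of `f` at `z` has `|y| = 1` and `G(y) = G(1) z`. Injectivity of `G` on
the circle leaves only `w`, and compactness gives the limit. -/
lemma IsNormalizedSlitMap.tendsto_boundary (hf : IsNormalizedSlitMap q L f)
    (hq : q ∈ Ioo (0 : ℝ) 1) (hL : L ∈ Ioo (0 : ℝ) 1) (hρ : 1 < ρ)
    (hG : IsSlitUniformizer L ρ G) {z w : ℂ} (hz : ‖z‖ = 1) (hw : ‖w‖ = 1)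
    (hzw : G w = G 1 * z) : Tendsto f (𝓝[annulus q] z) (𝓝 w) := by
  have hlt : ∀ᶠ z in 𝓝[annulus q] z, f z ∈ Metric.closedBall (0 : ℂ) 1 :=
    eventually_nhdsWithin_of_forall fun z hz => Metric.ball_subset_closedBall (hf.1.2.mapsTo hz).1
  refine (isCompact_closedBall (0 : ℂ) 1).tendsto_nhds_of_unique_mapClusterPt hlt fun y _ hy => ?_
  obtain ⟨U, hU, hUy⟩ := mapClusterPt_iff_ultrafilter.1 hy
  have hy1 : ‖y‖ = 1 := tendsto_nhds_unique hUy.norm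
    (((hf.tendsto_norm_outerEnd hq hL.2).mono_left (nhdsWithin_annulus_le_outerEnd q hz)).mono_left
      hU)
  have hm := IsSlitUniformizer.mem_domain hL (w := y) (by rw [hy1]; exact hL.2) hy1.le
  have h1 := (hG.differentiableAt y hm.1 hm.2).continuousAt.tendsto.comp hUy
  have h2 : Tendsto (fun z => G 1 * z) (𝓝[annulus q] z) (𝓝 (G 1 * z)) :=
    ((continuous_const.mul continuous_id).tendsto z).mono_left nhdsWithin_le_nhds
  have hev : ∀ᶠ z in 𝓝[annulus q] z, G 1 * z = G (f z) :=
    eventually_nhdsWithin_of_forall fun z hz => (hf.uniformizer_comp hq hL hρ hG z hz).symm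
  have h3 := tendsto_nhds_unique h1 ((h2.congr' hev).mono_left hU)
  exact hG.injOn_circle hL hy1 hw (h3.trans hzw.symm)

lemma IsNormalizedSlitMap.exists_tendsto (hf : IsNormalizedSlitMap q L f)
    (hq : q ∈ Ioo (0 : ℝ) 1) (hL : L ∈ Ioo (0 : ℝ) 1) (hρ : 1 < ρ)
    (hG : IsSlitUniformizer L ρ G) {z : ℂ} (hz : z ∈ annulusOuter q) :
    ∃ w, Tendsto f (𝓝[annulus q] z) (𝓝 w) ∧ G w = G 1 * z := by
  rcases eq_or_lt_of_le hz.2 with h1 | h1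
  · obtain ⟨w, hw, hzw⟩ := hG.exists_circle_eq_mul hL h1
    exact ⟨w, hf.tendsto_boundary hq hL hρ hG h1 hw hzw, hzw⟩
  · have hzA : z ∈ annulus q := ⟨hz.1, h1⟩
    exact ⟨f z, (hf.1.1.continuousOn z hzA), hf.uniformizer_comp hq hL hρ hG z hzA⟩

/-- The function `G / G(1)` is a left inverse of the continuous extension up to the outer circle, so
the inverse function rule gives the one-sided derivative. -/
lemma IsNormalizedSlitMap.hasDerivWithinAt_boundaryExtension (hf : IsNormalizedSlitMap q L f)
    (hq : q ∈ Ioo (0 : ℝ) 1) (hL : L ∈ Ioo (0 : ℝ) 1) (hρ : 1 < ρ)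
    (hG : IsSlitUniformizer L ρ G) {z w D : ℂ} (hz : ‖z‖ = 1) (hw : ‖w‖ = 1)
    (hzw : G w = G 1 * z) (hD : HasDerivAt G D w) (hD0 : D ≠ 0) :
    boundaryExtension q f z = w ∧
      HasDerivWithinAt (boundaryExtension q f) (G 1 / D) (annulusOuter q) z := by
  have hext : ∀ {z w}, z ∈ annulusOuter q → Tendsto f (𝓝[annulus q] z) (𝓝 w) →
      boundaryExtension q f z = w := fun hz h => extendFrom_eq (mem_closure_annulus hq hz) h
  have hzO := mem_annulusOuter_of_norm hq.2 hz
  have hEz := hext hzO (hf.tendsto_boundary hq hL hρ hG hz hw hzw)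
  refine ⟨hEz, ?_⟩
  have hcont : ContinuousOn (boundaryExtension q f) (annulusOuter q) :=
    continuousOn_extendFrom (fun z hz => mem_closure_annulus hq hz) fun z hz => by
      obtain ⟨w, hw, -⟩ := hf.exists_tendsto hq hL hρ hG hz
      exact ⟨w, hw⟩
  have hG1 := hG.ne_zero 1
  have hleft : ∀ z ∈ annulusOuter q, G (boundaryExtension q f z) / G 1 = z := fun z hz => by
    obtain ⟨w, hw, hzw⟩ := hf.exists_tendsto hq hL hρ hG hz
    rw [hext hz hw, hzw, mul_div_cancel_left₀ _ hG1]
  have hD' : D / G 1 ≠ 0 := div_ne_zero hD0 hG1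
  have hder : HasFDerivWithinAt (fun w => G w / G 1)
      ((ContinuousLinearEquiv.unitsEquivAut ℂ (Units.mk0 _ hD') : ℂ ≃L[ℂ] ℂ) : ℂ →L[ℂ] ℂ) univ
      (boundaryExtension q f z) := by
    rw [hEz, hasFDerivWithinAt_univ]
    exact (hD.div_const (G 1)).hasFDerivAt_equiv hD'
  have := hder.of_local_left_inverse (g := boundaryExtension q f) (s := annulusOuter q)
    (by rw [nhdsWithin_univ]; exact hcont z hzO) hzO
    (eventually_nhdsWithin_of_forall hleft)
  have h2 := this.hasDerivWithinAt
  refine h2.congr_deriv ?_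
  simp

/-- Boundary values and boundary derivatives of a normalized slit map. -/
lemma IsNormalizedSlitMap.boundary (hf : IsNormalizedSlitMap q L f)
    (hq : q ∈ Ioo (0 : ℝ) 1) (hL : L ∈ Ioo (0 : ℝ) 1) (hρ : 1 < ρ)
    (hG : IsSlitUniformizer L ρ G) {τ θ : ℝ}
    (h : G (Complex.exp (θ * Complex.I)) = G 1 * Complex.exp (τ * Complex.I)) :
    DifferentiableWithinAt ℂ (boundaryExtension q f) (annulusOuter q)
      (Complex.exp (τ * Complex.I)) ∧
    boundaryExtension q f (Complex.exp (τ * Complex.I)) = Complex.exp (θ * Complex.I) ∧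
    ‖boundaryDeriv q f (Complex.exp (τ * Complex.I))‖ = angularMean (L ^ 2) *
      ‖1 - ((L ^ 2 : ℝ) : ℂ) * Complex.exp (2 * (θ * Complex.I))‖ := by
  have hz := Complex.norm_exp_ofReal_mul_I τ
  have hw := Complex.norm_exp_ofReal_mul_I θ
  have hκ := angularMean_pos (sq_mem_Ioo hL)
  have hN : 0 < ‖1 - ((L ^ 2 : ℝ) : ℂ) * Complex.exp (2 * (θ * Complex.I))‖ :=
    norm_pos_iff.2 (one_sub_mul_exp_ne_zero (sq_mem_Ioo hL) θ)
  set N := ‖1 - ((L ^ 2 : ℝ) : ℂ) * Complex.exp (2 * (θ * Complex.I))‖ with hNdef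
  have hD0 : G (Complex.exp (θ * Complex.I)) / (Complex.exp (θ * Complex.I) *
      (angularMean (L ^ 2) * N : ℝ)) ≠ 0 :=
    div_ne_zero (hG.ne_zero _) (mul_ne_zero (Complex.exp_ne_zero _)
      (by exact_mod_cast (mul_pos hκ hN).ne'))
  obtain ⟨h1, h2⟩ := hf.hasDerivWithinAt_boundaryExtension hq hL hρ hG hz hw h
    (hG.deriv_circle θ) hD0
  refine ⟨h2.differentiableWithinAt, h1, ?_⟩
  rw [boundaryDeriv, h2.derivWithin (uniqueDiffWithinAt_annulusOuter hq.2 hz)]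
  rw [norm_div, norm_div, norm_mul, hG.norm_circle hw, hw, hG.norm_one, one_mul,
    Complex.norm_real, Real.norm_of_nonneg (mul_pos hκ hN).le,
    div_div_cancel₀ (by linarith)]

end Boundary

/-! ### Elementary estimates. -/

lemma sq_norm_one_sub_mul_exp (p φ : ℝ) :
    ‖1 - (p : ℂ) * Complex.exp (2 * (φ * Complex.I))‖ ^ 2 =
      (1 - p) ^ 2 + 4 * p * Real.sin φ ^ 2 := by
  have : 1 - (p : ℂ) * Complex.exp (2 * (φ * Complex.I)) =
      ((1 - p * Real.cos (2 * φ) : ℝ) : ℂ) + ((-p * Real.sin (2 * φ) : ℝ) : ℂ) * Complex.I := by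
    have h : (2 * (φ * Complex.I) : ℂ) = ((2 * φ : ℝ) : ℂ) * Complex.I := by push_cast; ring
    rw [h, Complex.exp_mul_I]
    push_cast
    ring
  rw [this, Complex.sq_norm, Complex.normSq_add_mul_I]
  have h1 := Real.sin_sq_add_cos_sq (2 * φ)
  have h2 := Real.cos_two_mul φ
  have h3 := Real.sin_sq_add_cos_sq φ
  linear_combination p ^ 2 * h1 - 2 * p * h2 - 4 * p * h3

lemma one_sub_le_norm (p φ : ℝ) (hp : p ∈ Ioo (0 : ℝ) 1) :
    1 - p ≤ ‖1 - (p : ℂ) * Complex.exp (2 * (φ * Complex.I))‖ := by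
  refine le_of_sq_le_sq ?_ (norm_nonneg _)
  rw [sq_norm_one_sub_mul_exp]
  nlinarith [hp.1, sq_nonneg (Real.sin φ)]

lemma angularMean_le {p : ℝ} (hp : p ∈ Ioo (0 : ℝ) 1) : angularMean p ≤ 1 / (1 - p) := by
  have hp1 : 0 < 1 - p := by linarith [hp.2]
  have hmono : Monotone fun θ => 1 / (1 - p) * θ - angularInt p θ := by
    refine monotone_of_hasDerivAt_nonneg
      (fun θ => ((hasDerivAt_id θ).const_mul (1 / (1 - p))).sub (hasDerivAt_angularInt hp θ))
      fun θ => ?_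
    simp only [mul_one, Pi.zero_apply, sub_nonneg]
    exact one_div_le_one_div_of_le hp1 (one_sub_le_norm p θ hp)
  have := hmono Real.pi_pos.le
  simp only [mul_zero, angularInt_zero, sub_zero] at this
  rw [angularMean, div_le_iff₀ Real.pi_pos]
  linarith

lemma two_mul_sin_le_norm (L φ : ℝ) :
    2 * L * Real.sin φ ≤ ‖1 - ((L ^ 2 : ℝ) : ℂ) * Complex.exp (2 * (φ * Complex.I))‖ := by
  refine le_of_sq_le_sq ?_ (norm_nonneg _)
  rw [sq_norm_one_sub_mul_exp]
  nlinarith [sq_nonneg (1 - L ^ 2)]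

/-- With a factor `cos θ` the integrand would integrate to the `arsinh` exactly. The discrepancy
`2L(1 - cos θ) / |1 - L² e^{2iθ}|` lies in `[0, 1]`, since `1 - cos θ ≤ sin θ` on the quarter circle
and `2L sin θ` is at most the denominator. -/
lemma angularInt_bounds {L θ : ℝ} (hL : L ∈ Ioo (0 : ℝ) 1) (hθ : θ ∈ Icc 0 (Real.pi / 2)) :
    Real.arsinh (2 * L / (1 - L ^ 2) * Real.sin θ) ≤ 2 * L * angularInt (L ^ 2) θ ∧
      2 * L * angularInt (L ^ 2) θ ≤ Real.arsinh (2 * L / (1 - L ^ 2) * Real.sin θ) + θ := by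
  have hp := sq_mem_Ioo hL
  have hp1 : 0 < 1 - L ^ 2 := by linarith [hp.2]
  set A := 2 * L / (1 - L ^ 2) with hA
  set N : ℝ → ℝ := fun θ => ‖1 - ((L ^ 2 : ℝ) : ℂ) * Complex.exp (2 * (θ * Complex.I))‖ with hN
  have hN0 : ∀ θ, 0 < N θ := fun θ => norm_pos_iff.2 (one_sub_mul_exp_ne_zero hp θ)
  have hF : ∀ θ, HasDerivAt (fun θ => Real.arsinh (A * Real.sin θ))
      (2 * L * Real.cos θ / N θ) θ := fun θ => by
    have h1 := ((Real.hasDerivAt_sin θ).const_mul A).arsinh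
    refine h1.congr_deriv ?_
    have h2 : N θ = (1 - L ^ 2) * √(1 + (A * Real.sin θ) ^ 2) := by
      rw [← sq_eq_sq₀ (hN0 θ).le (by positivity), mul_pow, Real.sq_sqrt (by positivity), hN]
      simp only
      rw [sq_norm_one_sub_mul_exp, hA]
      field_simp
      ring
    rw [h2, hA, smul_eq_mul]
    field_simp
  have hJ : ∀ θ, HasDerivAt (fun θ => 2 * L * angularInt (L ^ 2) θ) (2 * L * (1 / N θ)) θ :=
    fun θ => (hasDerivAt_angularInt hp θ).const_mul _
  have mono : ∀ {F F' : ℝ → ℝ}, (∀ x ∈ Icc 0 θ, HasDerivAt F (F' x) x) →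
      (∀ x ∈ Icc 0 θ, 0 ≤ F' x) → F 0 ≤ F θ := fun {F F'} hF hF' => by
    refine monotoneOn_of_hasDerivWithinAt_nonneg (convex_Icc 0 θ)
      (fun x hx => (hF x hx).continuousAt.continuousWithinAt)
      (fun x hx => (hF x (interior_subset hx)).hasDerivWithinAt)
      (fun x hx => hF' x (interior_subset hx)) (left_mem_Icc.2 hθ.1) (right_mem_Icc.2 hθ.1) hθ.1
  constructor
  · have := mono (fun x _ => (hJ x).sub (hF x)) fun x _ => by
      have h1 : 2 * L * (1 / N x) - 2 * L * Real.cos x / N x =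
          2 * L * (1 - Real.cos x) / N x := by ring
      rw [h1]
      exact div_nonneg (mul_nonneg (by linarith [hL.1]) (by linarith [Real.cos_le_one x]))
        (hN0 x).le
    simp at this
    exact this
  · have := mono (fun x _ => ((hF x).add (hasDerivAt_id x)).sub (hJ x)) fun x hx => by
      have hs : 0 ≤ Real.sin x := Real.sin_nonneg_of_nonneg_of_le_pi hx.1
        (by linarith [hx.2, hθ.2, Real.pi_pos])
      have hc : 0 ≤ Real.cos x := Real.cos_nonneg_of_neg_pi_div_two_le_of_le
        (by linarith [hx.1, Real.pi_pos]) (hx.2.trans hθ.2)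
      have h1 : 2 * L * Real.cos x / N x + 1 - 2 * L * (1 / N x) =
          (N x - 2 * L * (1 - Real.cos x)) / N x := by
        have := (hN0 x).ne'
        field_simp
        ring
      rw [h1]
      refine div_nonneg ?_ (hN0 x).le
      have h2 := two_mul_sin_le_norm L x
      have h3 : 1 - Real.cos x ≤ Real.sin x := by
        nlinarith [Real.sin_sq_add_cos_sq x, Real.cos_le_one x]
      have h4 : 2 * L * (1 - Real.cos x) ≤ 2 * L * Real.sin x :=
        mul_le_mul_of_nonneg_left h3 (by linarith [hL.1])
      simp only [hN]
      linarith
    simp at this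
    linarith

lemma arsinh_eq_log {L : ℝ} (hL : L ∈ Ioo (0 : ℝ) 1) :
    Real.arsinh (2 * L / (1 - L ^ 2)) = Real.log (1 + L) - Real.log (1 - L) := by
  have h1 : 0 < 1 - L := by linarith [hL.2]
  have h2 : 0 < 1 + L := by linarith [hL.1]
  rw [← Real.log_div h2.ne' h1.ne', Real.arsinh]
  congr 1
  have h3 : √(1 + (2 * L / (1 - L ^ 2)) ^ 2) = (1 + L ^ 2) / (1 - L ^ 2) := by
    have h4 : 0 < 1 - L ^ 2 := by nlinarith
    rw [← Real.sqrt_sq (show 0 ≤ (1 + L ^ 2) / (1 - L ^ 2) by positivity)]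
    congr 1
    field_simp
    ring
  rw [h3]
  have h4 : 1 - L ^ 2 = (1 - L) * (1 + L) := by ring
  rw [h4]
  field_simp
  ring

lemma log_le_arsinh {y : ℝ} (hy : 0 < y) : Real.log y ≤ Real.arsinh y :=
  Real.log_le_log hy (by linarith [Real.sqrt_nonneg (1 + y ^ 2)])

lemma arsinh_le_log {y : ℝ} (hy : 1 ≤ y) : Real.arsinh y ≤ Real.log y + Real.log 3 := by
  rw [← Real.log_mul (by linarith) (by norm_num), Real.arsinh]
  refine Real.log_le_log (by positivity) ?_
  have : √(1 + y ^ 2) ≤ 2 * y := Real.sqrt_le_iff.2 ⟨by linarith, by nlinarith⟩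
  linarith

lemma sin_le_norm_one_sub_exp {θ : ℝ} (hθ : θ ∈ Icc 0 (Real.pi / 2)) :
    Real.sin θ ≤ ‖1 - Complex.exp (θ * Complex.I)‖ ∧
      ‖1 - Complex.exp (θ * Complex.I)‖ ≤ 2 * Real.sin θ := by
  have hs : 0 ≤ Real.sin θ := Real.sin_nonneg_of_nonneg_of_le_pi hθ.1
    (by linarith [hθ.2, Real.pi_pos])
  have hc : 0 ≤ Real.cos θ := Real.cos_nonneg_of_neg_pi_div_two_le_of_le
    (by linarith [hθ.1, Real.pi_pos]) hθ.2
  have h1 := Real.sin_sq_add_cos_sq θ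
  have h2 := Real.cos_le_one θ
  have hn : ‖1 - Complex.exp (θ * Complex.I)‖ ^ 2 = 2 - 2 * Real.cos θ := by
    have : 1 - Complex.exp (θ * Complex.I) =
        ((1 - Real.cos θ : ℝ) : ℂ) + ((-Real.sin θ : ℝ) : ℂ) * Complex.I := by
      rw [Complex.exp_mul_I]; push_cast; ring
    rw [this, Complex.sq_norm, Complex.normSq_add_mul_I]
    linear_combination h1
  constructor
  · refine le_of_sq_le_sq ?_ (norm_nonneg _)
    rw [hn]; nlinarith
  · refine le_of_sq_le_sq ?_ (by linarith)
    rw [hn]; nlinarith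

/-! ### Logarithmic asymptotics as limits of `a log h(a)`. -/

lemma tendsto_mul_of_abs_sub_le {u v : ℝ → ℝ} {ℓ C : ℝ}
    (hu : Tendsto (fun a => a * u a) (𝓝[<] 0) (𝓝 ℓ))
    (h : ∀ᶠ a in 𝓝[<] (0 : ℝ), |v a - u a| ≤ C) :
    Tendsto (fun a => a * v a) (𝓝[<] 0) (𝓝 ℓ) := by
  have h0 : Tendsto (fun a : ℝ => a * (v a - u a)) (𝓝[<] 0) (𝓝 0) := by
    have hid : Tendsto (fun a : ℝ => |a| * C) (𝓝[<] 0) (𝓝 0) := by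
      have : Continuous fun a : ℝ => |a| * C := by fun_prop
      simpa using (this.tendsto 0).mono_left (nhdsWithin_le_nhds (s := Iio 0))
    refine squeeze_zero_norm' ?_ hid
    filter_upwards [h] with a ha
    rw [Real.norm_eq_abs, abs_mul]
    exact mul_le_mul_of_nonneg_left ha (abs_nonneg _)
  have := hu.add h0
  rw [add_zero] at this
  refine this.congr fun a => ?_
  ring

lemma tendsto_mul_log_of_le {u v : ℝ → ℝ} {ℓ C : ℝ} (hC : 1 ≤ C)
    (hu : Tendsto (fun a => a * Real.log (u a)) (𝓝[<] 0) (𝓝 ℓ))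
    (h : ∀ᶠ a in 𝓝[<] (0 : ℝ), 0 < u a ∧ u a ≤ v a ∧ v a ≤ C * u a) :
    Tendsto (fun a => a * Real.log (v a)) (𝓝[<] 0) (𝓝 ℓ) := by
  refine tendsto_mul_of_abs_sub_le (C := Real.log C) hu ?_
  filter_upwards [h] with a ⟨h1, h2, h3⟩
  have h4 := Real.log_le_log h1 h2
  have h5 := Real.log_le_log (h1.trans_le h2) h3
  rw [Real.log_mul (by linarith) h1.ne'] at h5
  rw [abs_of_nonneg (by linarith)]
  linarith

lemma logAsymp_exp {h : ℝ → ℝ} {c : ℝ} (hc : c ≠ 0)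
    (hh : Tendsto (fun a => a * Real.log (h a)) (𝓝[<] 0) (𝓝 c)) :
    LogAsymp h (fun a => Real.exp (c / a)) := by
  have := hh.div_const c
  rw [div_self hc] at this
  refine this.congr' (eventually_nhdsWithin_of_forall fun a ha => ?_)
  have ha0 : a ≠ 0 := ne_of_lt ha
  simp only [Real.log_exp]
  field_simp

lemma logAsymp_of_tendsto {h g : ℝ → ℝ} {c : ℝ} (hc : c ≠ 0)
    (hh : Tendsto (fun a => a * Real.log (h a)) (𝓝[<] 0) (𝓝 c))
    (hg : Tendsto (fun a => a * Real.log (g a)) (𝓝[<] 0) (𝓝 c)) : LogAsymp h g := by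
  have := hh.div hg hc
  rw [div_self hc] at this
  refine this.congr' (eventually_nhdsWithin_of_forall fun a ha => ?_)
  exact mul_div_mul_left _ _ (ne_of_lt ha)

/-! ### Asymptotics of the slit length and of the boundary angle. -/

/-- The relation between the modulus `e^a` of the annulus and the half-length of the slit. -/
structure IsModulusRelation (L : ℝ → ℝ) : Prop where
  mem : ∀ a < 0, L a ∈ Ioo (0 : ℝ) 1
  le_arcsin : ∀ a < 0, L a ^ 2 * (-a * angularMean (L a ^ 2)) ≤
    Real.arcsin (L a / √(1 + L a ^ 2))
  arcsin_le : ∀ a < 0, Real.arcsin (L a / √(1 + L a ^ 2)) ≤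
    L a * (-a * angularMean (L a ^ 2))

namespace IsModulusRelation

variable {L : ℝ → ℝ}

lemma eventually_neg {P : ℝ → Prop} (h : ∀ a < 0, P a) : ∀ᶠ a in 𝓝[<] (0 : ℝ), P a :=
  eventually_nhdsWithin_of_forall h

/-- A crude bound that only serves to show `L → 1`: the arcsine is at least `L/2` and `κ ≤ 1/(1 -
L²)`. -/
lemma one_sub_sq_le (h : IsModulusRelation L) {a : ℝ} (ha : a < 0) : 1 - L a ^ 2 ≤ -2 * a := by
  have hL := h.mem a ha
  have hp := sq_mem_Ioo hL
  have hp1 : 0 < 1 - L a ^ 2 := by linarith [hp.2]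
  have h1 := h.arcsin_le a ha
  have hs : √(1 + L a ^ 2) ≤ 2 := Real.sqrt_le_iff.2 ⟨by norm_num, by linarith [hp.2]⟩
  have hs0 : 0 < √(1 + L a ^ 2) := Real.sqrt_pos.2 (by positivity)
  have h2 : L a / √(1 + L a ^ 2) ≤ Real.arcsin (L a / √(1 + L a ^ 2)) := by
    have hn : 0 ≤ Real.arcsin (L a / √(1 + L a ^ 2)) :=
      Real.arcsin_nonneg.2 (div_nonneg hL.1.le hs0.le)
    have hle : L a / √(1 + L a ^ 2) ≤ 1 := by
      rw [div_le_one hs0]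
      exact Real.le_sqrt_of_sq_le (by linarith)
    have := Real.sin_le hn
    rwa [Real.sin_arcsin (by linarith [div_nonneg hL.1.le hs0.le]) hle] at this
  have h3 : L a / 2 ≤ L a / √(1 + L a ^ 2) := div_le_div_of_nonneg_left hL.1.le hs0 hs
  have h4 : L a * (1 / 2) ≤ L a * (-a * angularMean (L a ^ 2)) := by linarith
  have h5 := le_of_mul_le_mul_left h4 hL.1
  have h6 : -a * angularMean (L a ^ 2) ≤ -a * (1 / (1 - L a ^ 2)) :=
    mul_le_mul_of_nonneg_left (angularMean_le hp) (by linarith)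
  have h7 := h5.trans h6
  rw [mul_one_div, le_div_iff₀ hp1] at h7
  linarith

lemma tendsto_one (h : IsModulusRelation L) : Tendsto L (𝓝[<] 0) (𝓝 1) := by
  have h1 : Tendsto (fun a : ℝ => 1 + 2 * a) (𝓝[<] 0) (𝓝 1) := by
    have : Continuous fun a : ℝ => 1 + 2 * a := by fun_prop
    simpa using (this.tendsto 0).mono_left (nhdsWithin_le_nhds (s := Iio 0))
  refine tendsto_of_tendsto_of_tendsto_of_le_of_le' h1 tendsto_const_nhds
    (eventually_neg fun a ha => ?_) (eventually_neg fun a ha => (h.mem a ha).2.le)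
  have := h.one_sub_sq_le ha
  nlinarith [(h.mem a ha).1, (h.mem a ha).2]

lemma tendsto_mul_mean (h : IsModulusRelation L) :
    Tendsto (fun a => a * angularMean (L a ^ 2)) (𝓝[<] 0) (𝓝 (-(Real.pi / 4))) := by
  have hL1 := h.tendsto_one
  have harc : Tendsto (fun a => Real.arcsin (L a / √(1 + L a ^ 2))) (𝓝[<] 0)
      (𝓝 (Real.pi / 4)) := by
    have hc : ContinuousAt (fun x : ℝ => Real.arcsin (x / √(1 + x ^ 2))) 1 := by
      refine Real.continuous_arcsin.continuousAt.comp ?_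
      exact continuousAt_id.div (by fun_prop) (Real.sqrt_pos.2 (by norm_num)).ne'
    have hv : Real.arcsin (1 / √(1 + 1 ^ 2)) = Real.pi / 4 := by
      refine Real.arcsin_eq_of_sin_eq ?_ ⟨by linarith [Real.pi_pos], by linarith [Real.pi_pos]⟩
      rw [Real.sin_pi_div_four, one_pow, one_add_one_eq_two, div_eq_div_iff two_ne_zero
        (Real.sqrt_pos.2 two_pos).ne', Real.mul_self_sqrt two_pos.le, one_mul]
    have := hc.tendsto.comp hL1
    rwa [hv] at this
  have h1 := harc.div hL1 one_ne_zero
  have h2 := harc.div (hL1.pow 2) (by norm_num)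
  rw [div_one] at h1
  rw [one_pow, div_one] at h2
  have h3 : Tendsto (fun a => -a * angularMean (L a ^ 2)) (𝓝[<] 0) (𝓝 (Real.pi / 4)) := by
    refine tendsto_of_tendsto_of_tendsto_of_le_of_le' h1 h2 (eventually_neg fun a ha => ?_)
      (eventually_neg fun a ha => ?_)
    · simp only [Pi.div_apply]
      rw [div_le_iff₀' (h.mem a ha).1]
      exact h.arcsin_le a ha
    · simp only [Pi.div_apply]
      rw [le_div_iff₀' (pow_pos (h.mem a ha).1 2)]
      exact h.le_arcsin a ha
  simpa using h3.neg

lemma tendsto_mul_mul_mean (h : IsModulusRelation L) (c : ℝ) :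
    Tendsto (fun a => a * (L a * angularMean (L a ^ 2) * c)) (𝓝[<] 0)
      (𝓝 (-(Real.pi / 4) * c)) := by
  have := (h.tendsto_one.mul h.tendsto_mul_mean).mul_const c
  rw [one_mul] at this
  refine this.congr fun a => ?_
  ring

/-- A bounded quantity times `a` is negligible. -/
lemma tendsto_mul_zero {v : ℝ → ℝ} {C : ℝ} (hv : ∀ᶠ a in 𝓝[<] (0 : ℝ), |v a| ≤ C) :
    Tendsto (fun a => a * v a) (𝓝[<] 0) (𝓝 0) :=
  tendsto_mul_of_abs_sub_le (u := fun _ => 0) (C := C) (by simp)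
    (by simpa using hv)

lemma tendsto_mul_log_one_add (h : IsModulusRelation L) :
    Tendsto (fun a => a * Real.log (1 + L a)) (𝓝[<] 0) (𝓝 0) := by
  refine tendsto_mul_zero (C := 1) (eventually_neg fun a ha => ?_)
  have hL := h.mem a ha
  rw [abs_of_nonneg (Real.log_nonneg (by linarith [hL.1]))]
  linarith [Real.log_le_sub_one_of_pos (show 0 < 1 + L a by linarith [hL.1]), hL.2]

/-- At `θ = π/2` the angular bound reads `log((1 + L)/(1 - L)) = L κ π + O(1)`. -/
lemma tendsto_mul_log_one_sub (h : IsModulusRelation L) :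
    Tendsto (fun a => a * Real.log (1 - L a)) (𝓝[<] 0) (𝓝 (Real.pi ^ 2 / 4)) := by
  have h1 := tendsto_mul_of_abs_sub_le
    (v := fun a => Real.log (1 + L a) - Real.log (1 - L a)) (C := 2)
    (h.tendsto_mul_mul_mean Real.pi) (eventually_neg fun a ha => by
      have hL := h.mem a ha
      have hb := angularInt_bounds hL (θ := Real.pi / 2)
        ⟨by linarith [Real.pi_pos], le_rfl⟩
      rw [Real.sin_pi_div_two, mul_one, arsinh_eq_log hL,
        angularInt_pi_div_two (sq_mem_Ioo hL)] at hb
      rw [abs_le]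
      constructor <;> linarith [hb.1, hb.2, Real.pi_le_four])
  have h2 := h.tendsto_mul_log_one_add.sub h1
  have h3 : 0 - -(Real.pi / 4) * Real.pi = Real.pi ^ 2 / 4 := by ring
  rw [h3] at h2
  refine h2.congr fun a => ?_
  ring

/-- Since `-a κ → π/4`, `log κ` differs from `-log(-a)` by a bounded amount, and `a log(-a) → 0`. -/
lemma tendsto_mul_log_mean (h : IsModulusRelation L) :
    Tendsto (fun a => a * Real.log (angularMean (L a ^ 2))) (𝓝[<] 0) (𝓝 0) := by
  have h0 : Tendsto (fun a : ℝ => a * Real.log (-a)) (𝓝[<] 0) (𝓝 0) := by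
    have h1 : Tendsto (fun a : ℝ => a * Real.log a) (𝓝[<] 0) (𝓝 0) := by
      have := Real.continuous_mul_log.tendsto 0
      simp only [zero_mul] at this
      exact this.mono_left nhdsWithin_le_nhds
    simpa using h1
  have h1 : Tendsto (fun a => Real.log (-a * angularMean (L a ^ 2))) (𝓝[<] 0)
      (𝓝 (Real.log (Real.pi / 4))) := by
    have := h.tendsto_mul_mean.neg
    rw [neg_neg] at this
    refine (this.congr fun a => ?_).log (by positivity)
    ring
  have hid : Tendsto (fun a : ℝ => a) (𝓝[<] 0) (𝓝 0) := tendsto_id.mono_left nhdsWithin_le_nhds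
  have h2 := (hid.mul h1).sub h0
  rw [zero_mul, sub_zero] at h2
  refine h2.congr' (eventually_neg fun a ha => ?_)
  have hκ := angularMean_pos (sq_mem_Ioo (h.mem a ha))
  rw [Real.log_mul (by linarith) hκ.ne']
  ring

variable {θ : ℝ → ℝ} {x : ℝ}

/-- Asymptotics of the boundary angle. -/
lemma tendsto_mul_log_sin (h : IsModulusRelation L) (hx : 0 < x)
    (hθ : ∀ a < 0, θ a ∈ Ioc 0 (Real.pi / 2))
    (hJ : ∀ a < 0, angularInt (L a ^ 2) (θ a) = angularMean (L a ^ 2) * (x / 2)) :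
    Tendsto (fun a => a * Real.log (Real.sin (θ a))) (𝓝[<] 0) (𝓝 (Real.pi / 4 * (Real.pi - x))) ∧
    ∀ᶠ a in 𝓝[<] (0 : ℝ), 1 - L a ^ 2 ≤ 2 * L a * Real.sin (θ a) ∧ 1 / 2 ≤ L a := by
  set y : ℝ → ℝ := fun a => 2 * L a / (1 - L a ^ 2) * Real.sin (θ a) with hy
  have hL1 : ∀ a < 0, 0 < 1 - L a ^ 2 := fun a ha => by linarith [(sq_mem_Ioo (h.mem a ha)).2]
  have hsin : ∀ a < 0, 0 < Real.sin (θ a) := fun a ha =>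
    Real.sin_pos_of_pos_of_lt_pi (hθ a ha).1 (by linarith [(hθ a ha).2, Real.pi_pos])
  have hb : ∀ a < 0, Real.arsinh (y a) ≤ L a * angularMean (L a ^ 2) * x ∧
      L a * angularMean (L a ^ 2) * x ≤ Real.arsinh (y a) + 2 := fun a ha => by
    have := angularInt_bounds (h.mem a ha) (θ := θ a) ⟨(hθ a ha).1.le, (hθ a ha).2⟩
    rw [hJ a ha] at this
    exact ⟨by linarith [this.1], by linarith [this.2, (hθ a ha).2, Real.pi_le_four]⟩
  have hlim := h.tendsto_mul_mul_mean x
  have har : Tendsto (fun a => a * Real.arsinh (y a)) (𝓝[<] 0) (𝓝 (-(Real.pi / 4) * x)) :=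
    tendsto_mul_of_abs_sub_le (C := 2) hlim (eventually_neg fun a ha => by
      have := hb a ha
      rw [abs_le]
      constructor <;> linarith [this.1, this.2])
  have hneg : -(Real.pi / 4) * x < 0 := by
    have := mul_pos (div_pos Real.pi_pos four_pos) hx
    linarith
  have hid : Tendsto (fun a : ℝ => a * Real.arsinh 1) (𝓝[<] 0) (𝓝 0) := by
    have : Continuous fun a : ℝ => a * Real.arsinh 1 := by fun_prop
    simpa using (this.tendsto 0).mono_left (nhdsWithin_le_nhds (s := Iio 0))
  -- Here `x > 0` enters: `a arsinh(y)` has a negative limit, so `y` exceeds one. This allows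
  -- replacing `arsinh y` by `log y`, and it is the inequality `1 - L² ≤ 2L sin θ`.
  have hy1 : ∀ᶠ a in 𝓝[<] (0 : ℝ), 1 ≤ y a := by
    filter_upwards [har.eventually_lt hid hneg, self_mem_nhdsWithin] with a h1 ha
    have := (mul_lt_mul_left_of_neg (show a < 0 from ha)).1 h1
    exact (Real.arsinh_lt_arsinh.1 this).le
  have hlogy : Tendsto (fun a => a * Real.log (y a)) (𝓝[<] 0) (𝓝 (-(Real.pi / 4) * x)) :=
    tendsto_mul_of_abs_sub_le (C := Real.log 3) har (by
      filter_upwards [hy1] with a ha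
      have h1 := log_le_arsinh (show 0 < y a by linarith)
      have h2 := arsinh_le_log ha
      have h3 : 0 ≤ Real.log 3 := Real.log_nonneg (by norm_num)
      rw [abs_le]
      constructor <;> linarith)
  have hLhalf : ∀ᶠ a in 𝓝[<] (0 : ℝ), 1 / 2 ≤ L a :=
    (h.tendsto_one.eventually (lt_mem_nhds (by norm_num : (1 / 2 : ℝ) < 1))).mono fun _ h => h.le
  have hlog2L : Tendsto (fun a => a * Real.log (2 * L a)) (𝓝[<] 0) (𝓝 0) := by
    refine tendsto_mul_zero (C := 1) ?_
    filter_upwards [hLhalf, eventually_neg h.mem] with a h1 h2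
    rw [abs_of_nonneg (Real.log_nonneg (by linarith))]
    linarith [Real.log_le_sub_one_of_pos (show 0 < 2 * L a by linarith), h2.2]
  constructor
  · have h1 := ((hlogy.sub hlog2L).add h.tendsto_mul_log_one_sub).add h.tendsto_mul_log_one_add
    have h2 : -(Real.pi / 4) * x - 0 + Real.pi ^ 2 / 4 + 0 = Real.pi / 4 * (Real.pi - x) := by ring
    rw [h2] at h1
    refine h1.congr' (eventually_neg fun a ha => ?_)
    have hLa := h.mem a ha
    have e1 : 0 < 1 - L a := by linarith [hLa.2]
    have e2 : 0 < 1 + L a := by linarith [hLa.1]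
    have e3 : 0 < 2 * L a := by linarith [hLa.1]
    have e4 : 1 - L a ^ 2 = (1 - L a) * (1 + L a) := by ring
    rw [hy]
    simp only
    rw [e4, Real.log_mul (by positivity) (hsin a ha).ne', Real.log_div e3.ne' (by positivity),
      Real.log_mul e1.ne' e2.ne']
    ring
  · filter_upwards [hy1, hLhalf, self_mem_nhdsWithin] with a h1 h2 ha
    refine ⟨?_, h2⟩
    rw [hy] at h1
    simp only at h1
    rwa [div_mul_eq_mul_div, le_div_iff₀ (hL1 a ha), one_mul] at h1

lemma tendsto_mul_log_norm_one_sub_exp (h : IsModulusRelation L) (hx : 0 < x)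
    (hθ : ∀ a < 0, θ a ∈ Ioc 0 (Real.pi / 2))
    (hJ : ∀ a < 0, angularInt (L a ^ 2) (θ a) = angularMean (L a ^ 2) * (x / 2)) :
    Tendsto (fun a => a * Real.log ‖1 - Complex.exp (θ a * Complex.I)‖) (𝓝[<] 0)
      (𝓝 (Real.pi / 4 * (Real.pi - x))) := by
  refine tendsto_mul_log_of_le one_le_two (h.tendsto_mul_log_sin hx hθ hJ).1
    (eventually_neg fun a ha => ⟨?_, sin_le_norm_one_sub_exp ⟨(hθ a ha).1.le, (hθ a ha).2⟩⟩)
  exact Real.sin_pos_of_pos_of_lt_pi (hθ a ha).1 (by linarith [(hθ a ha).2, Real.pi_pos])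

/-- In `|1 - L² e^{2iθ}|² = (1 - L²)² + 4L² sin² θ` the first term is eventually dominated by the
second, so the modulus lies between `sin θ` and `4 sin θ`. -/
lemma tendsto_mul_log_mean_mul_norm (h : IsModulusRelation L) (hx : 0 < x)
    (hθ : ∀ a < 0, θ a ∈ Ioc 0 (Real.pi / 2))
    (hJ : ∀ a < 0, angularInt (L a ^ 2) (θ a) = angularMean (L a ^ 2) * (x / 2)) :
    Tendsto (fun a => a * Real.log (angularMean (L a ^ 2) *
      ‖1 - ((L a ^ 2 : ℝ) : ℂ) * Complex.exp (2 * (θ a * Complex.I))‖)) (𝓝[<] 0)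
      (𝓝 (Real.pi / 4 * (Real.pi - x))) := by
  obtain ⟨h1, h2⟩ := h.tendsto_mul_log_sin hx hθ hJ
  have h3 : Tendsto (fun a => a * Real.log
      ‖1 - ((L a ^ 2 : ℝ) : ℂ) * Complex.exp (2 * (θ a * Complex.I))‖) (𝓝[<] 0)
      (𝓝 (Real.pi / 4 * (Real.pi - x))) := by
    refine tendsto_mul_log_of_le (C := 4) (by norm_num) h1 ?_
    filter_upwards [h2, self_mem_nhdsWithin] with a h2 ha
    have hL := h.mem a ha
    have hp := sq_mem_Ioo hL
    have hs : 0 < Real.sin (θ a) :=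
      Real.sin_pos_of_pos_of_lt_pi (hθ a ha).1 (by linarith [(hθ a ha).2, Real.pi_pos])
    refine ⟨hs, le_trans ?_ (two_mul_sin_le_norm _ _), ?_⟩
    · nlinarith [h2.2]
    · refine le_of_sq_le_sq ?_ (by linarith)
      rw [sq_norm_one_sub_mul_exp]
      have h4 : 1 - L a ^ 2 ≤ 2 * Real.sin (θ a) := by nlinarith [h2.1, hL.2]
      nlinarith [hp.1, hp.2, sq_nonneg (Real.sin (θ a))]
  have h4 := h.tendsto_mul_log_mean.add h3
  rw [zero_add] at h4
  refine h4.congr' (eventually_neg fun a ha => ?_)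
  have hp := sq_mem_Ioo (h.mem a ha)
  simp only
  rw [Real.log_mul (angularMean_pos hp).ne' (norm_ne_zero_iff.2 (one_sub_mul_exp_ne_zero hp _))]
  ring

end IsModulusRelation

/-! ### Conclusion. -/

/-- A conformal equivalence with a slit disk determines a uniformizer of the slit disk. -/
lemma exists_uniformizer_of_conformallyEquivalent {a L : ℝ} (ha : a < 0) (hL : L ∈ Ico (0 : ℝ) 1)
    (h : ConformallyEquivalent (annulus (Real.exp a)) (slitDisk L)) :
    L ∈ Ioo (0 : ℝ) 1 ∧ (∃ ρ G, 1 < ρ ∧ IsSlitUniformizer L ρ G) ∧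
    L ^ 2 * (-a * angularMean (L ^ 2)) ≤ Real.arcsin (L / √(1 + L ^ 2)) ∧
    Real.arcsin (L / √(1 + L ^ 2)) ≤ L * (-a * angularMean (L ^ 2)) := by
  have hq : Real.exp a ∈ Ioo (0 : ℝ) 1 := ⟨Real.exp_pos a, Real.exp_lt_one_iff.2 ha⟩
  have hL0 : 0 < L := by
    refine lt_of_le_of_ne hL.1 ?_
    rintro rfl
    exact not_conformallyEquivalent_slitDisk_zero hq h
  have hLI : L ∈ Ioo (0 : ℝ) 1 := ⟨hL0, hL.2⟩
  have hκ := angularMean_pos (sq_mem_Ioo hLI)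
  obtain ⟨M, G, hG, hM1, hM2⟩ := exists_isSlitUniformizer hLI
  have hM : 0 < M := by
    have : 0 < Real.arcsin (L / √(1 + L ^ 2)) :=
      Real.arcsin_pos.2 (div_pos hL0 (Real.sqrt_pos.2 (by positivity)))
    exact (mul_pos_iff_of_pos_left hL0).1 (this.trans_le hM2)
  have hρ : 1 < Real.exp (M / angularMean (L ^ 2)) := Real.one_lt_exp_iff.2 (div_pos hM hκ)
  obtain ⟨f, hf⟩ := h
  have hr := (hG.rigidity hLI hρ hq hf).1
  rw [← Real.exp_add, Real.exp_eq_one_iff] at hr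
  have hMa : M = -a * angularMean (L ^ 2) := by
    field_simp at hr
    linarith
  rw [hMa] at hM1 hM2
  exact ⟨hLI, ⟨_, G, hρ, hG⟩, hM1, hM2⟩

lemma bdryPoint_eq (x : ℝ) : bdryPoint x = Complex.exp ((x / 2 : ℝ) * Complex.I) := by
  rw [bdryPoint]
  congr 1
  push_cast
  ring

theorem lemma4p6 (L : ℝ → ℝ)
    (hL : ∀ q ∈ Ioo (0 : ℝ) 1,
      L q ∈ Ico (0 : ℝ) 1 ∧ ConformallyEquivalent (annulus q) (slitDisk (L q))) :
    LogAsymp (fun a => 1 - L (Real.exp a)) (fun a => Real.exp (Real.pi ^ 2 / (4 * a))) ∧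
    ∀ f : ℝ → ℂ → ℂ, (∀ q ∈ Ioo (0 : ℝ) 1, IsNormalizedSlitMap q (L q) (f q)) →
      (∀ q ∈ Ioo (0 : ℝ) 1, ∀ z : ℂ, ‖z‖ = 1 →
        DifferentiableWithinAt ℂ (boundaryExtension q (f q)) (annulusOuter q) z) ∧
      (∀ x ∈ Ioo (0 : ℝ) Real.pi,
        LogAsymp (fun a => ‖boundaryDeriv (Real.exp a) (f (Real.exp a)) (bdryPoint x)‖)
          (fun a => ‖1 - boundaryExtension (Real.exp a) (f (Real.exp a)) (bdryPoint x)‖) ∧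
        LogAsymp (fun a => ‖1 - boundaryExtension (Real.exp a) (f (Real.exp a)) (bdryPoint x)‖)
          (fun a => Real.exp (Real.pi / (4 * a) * (Real.pi - x))) ∧
        LogAsymp (fun a => ‖boundaryDeriv (Real.exp a) (f (Real.exp a)) (bdryPoint x)‖)
          (fun a => Real.exp (Real.pi / (4 * a) * (Real.pi - x)))) ∧
      Tendsto (fun a : ℝ => a * Real.log
        ‖boundaryDeriv (Real.exp a) (f (Real.exp a)) (bdryPoint Real.pi)‖) (𝓝[<] 0) (𝓝 0) ∧
      Tendsto (fun a : ℝ => a * Real.log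
        ‖1 - boundaryExtension (Real.exp a) (f (Real.exp a)) (bdryPoint Real.pi)‖)
        (𝓝[<] 0) (𝓝 0) := by
  have hqI : ∀ a < 0, Real.exp a ∈ Ioo (0 : ℝ) 1 := fun a ha =>
    ⟨Real.exp_pos a, Real.exp_lt_one_iff.2 ha⟩
  have hU := fun a (ha : a < 0) =>
    exists_uniformizer_of_conformallyEquivalent ha (hL _ (hqI a ha)).1 (hL _ (hqI a ha)).2
  have hrel : IsModulusRelation fun a => L (Real.exp a) :=
    ⟨fun a ha => (hU a ha).1, fun a ha => (hU a ha).2.2.1, fun a ha => (hU a ha).2.2.2⟩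
  refine ⟨?_, fun f hf => ?_⟩
  · convert logAsymp_exp (by positivity) hrel.tendsto_mul_log_one_sub using 3 with a
    rw [div_div]
  have hmain : ∀ x ∈ Ioc (0 : ℝ) Real.pi,
      Tendsto (fun a : ℝ => a * Real.log
        ‖boundaryDeriv (Real.exp a) (f (Real.exp a)) (bdryPoint x)‖) (𝓝[<] 0)
        (𝓝 (Real.pi / 4 * (Real.pi - x))) ∧
      Tendsto (fun a : ℝ => a * Real.log
        ‖1 - boundaryExtension (Real.exp a) (f (Real.exp a)) (bdryPoint x)‖)
        (𝓝[<] 0) (𝓝 (Real.pi / 4 * (Real.pi - x))) := by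
    intro x hx
    have hex : ∀ a : ℝ, ∃ θ : ℝ, a < 0 → θ ∈ Ioc 0 (Real.pi / 2) ∧
        angularInt (L (Real.exp a) ^ 2) θ = angularMean (L (Real.exp a) ^ 2) * (x / 2) ∧
        boundaryExtension (Real.exp a) (f (Real.exp a)) (bdryPoint x) =
          Complex.exp (θ * Complex.I) ∧
        ‖boundaryDeriv (Real.exp a) (f (Real.exp a)) (bdryPoint x)‖ =
          angularMean (L (Real.exp a) ^ 2) * ‖1 - ((L (Real.exp a) ^ 2 : ℝ) : ℂ) *
            Complex.exp (2 * (θ * Complex.I))‖ := by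
      intro a
      by_cases ha : a < 0
      · obtain ⟨hLI, ⟨ρ, G, hρ, hG⟩, -⟩ := hU a ha
        obtain ⟨θ, hθ, hJ, hGθ⟩ := hG.exists_circle_eq hLI (a := 0) (b := Real.pi / 2)
          (τ := x / 2) (by linarith [Real.pi_pos]) (by simp)
          (angularInt_pi_div_two (sq_mem_Ioo hLI)) ⟨by linarith [hx.1], by linarith [hx.2]⟩
        have hb := (hf _ (hqI a ha)).boundary (hqI a ha) hLI hρ hG hGθ
        refine ⟨θ, fun _ => ⟨hθ, hJ, ?_, ?_⟩⟩
        · rw [bdryPoint_eq]; exact hb.2.1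
        · rw [bdryPoint_eq]; exact hb.2.2
      · exact ⟨0, fun h => absurd h ha⟩
    choose θ hθ using hex
    have h1 := hrel.tendsto_mul_log_mean_mul_norm hx.1 (fun a ha => (hθ a ha).1)
      (fun a ha => (hθ a ha).2.1)
    have h2 := hrel.tendsto_mul_log_norm_one_sub_exp hx.1 (fun a ha => (hθ a ha).1)
      (fun a ha => (hθ a ha).2.1)
    refine ⟨h1.congr' (eventually_nhdsWithin_of_forall fun a ha => ?_),
      h2.congr' (eventually_nhdsWithin_of_forall fun a ha => ?_)⟩
    · simp only [(hθ a ha).2.2.2]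
    · simp only [(hθ a ha).2.2.1]
  refine ⟨fun q hq z hz => ?_, fun x hx => ?_, ?_, ?_⟩
  · have ha := Real.log_neg hq.1 hq.2
    have hUa := hU _ ha
    rw [Real.exp_log hq.1] at hUa
    obtain ⟨hLI, ⟨ρ, G, hρ, hG⟩, -⟩ := hUa
    obtain ⟨w, hw, hzw⟩ := hG.exists_circle_eq_mul hLI hz
    have := ((hf q hq).boundary hq hLI hρ hG (τ := z.arg) (θ := w.arg)
      (by rw [exp_arg_mul_I hw, exp_arg_mul_I hz, hzw])).1
    rwa [exp_arg_mul_I hz] at this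
  · obtain ⟨h1, h2⟩ := hmain x ⟨hx.1, hx.2.le⟩
    -- Quotients of logarithms are controlled only when the limit is nonzero, that is for `x < π`;
    -- at `x = π` only the limits of `a log` survive.
    have hc : Real.pi / 4 * (Real.pi - x) ≠ 0 :=
      (mul_pos (by positivity) (sub_pos.2 hx.2)).ne'
    have he : (fun a : ℝ => Real.exp (Real.pi / (4 * a) * (Real.pi - x))) =
        fun a => Real.exp (Real.pi / 4 * (Real.pi - x) / a) := by
      funext a
      congr 1
      rw [div_mul_eq_mul_div, div_mul_eq_mul_div, div_div]
    rw [he]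
    exact ⟨logAsymp_of_tendsto hc h1 h2, logAsymp_exp hc h2, logAsymp_exp hc h1⟩
  · simpa using (hmain Real.pi ⟨Real.pi_pos, le_rfl⟩).1
  · simpa using (hmain Real.pi ⟨Real.pi_pos, le_rfl⟩).2
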